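/- Let $0<q<1$. Let $\mathcal A(\mathrm{SU}_q(2))$ be the $*$-algebra generated by $a,c$ with relations $ac=q\,ca$, $c^*a^*=q\,a^*c^*$, $ac^*=q\,c^*a$, $ca^*=q\,a^*c$, $cc^*=c^*c$, $a^*a+c^*c=aa^*+q^2cc^*=1$. It carries the left action $h\triangleright x=x_{(1)}\langle h,x_{(2)}\rangle$ of $\mathcal U_q(\mathrm{su}(2))$, the algebra generated by $K^{\pm1},E,F$ with $K^{\pm1}E=q^{\pm1}EK^{\pm1}$, $K^{\pm1}F=q^{\mp1}FK^{\pm1}$, $[E,F]=(K^2-K^{-2})/(q-q^{-1})$; the pairing is given on generators by $\langle K^{\pm1},a\rangle=q^{\mp1/2}$, $\langle K^{\pm1},a^*\rangle=q^{\pm1/2}$, $\langle E,c\rangle=1$, $\langle F,c^*\rangle=-q^{-1}$ (other pairs of generators pair to $0$), the coproduct of $\mathcal U_q(\mathrm{su}(2))$ by $\Delta(K^{\pm1})=K^{\pm1}\otimes K^{\pm1}$, $\Delta(E)=E\otimes K+K^{-1}\otimes E$, $\Delta(F)=F\otimes K+K^{-1}\otimes F$, and the coproduct $x\mapsto x_{(1)}\otimes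 x_{(2)}$ of $\mathcal A(\mathrm{SU}_q(2))$ is the one for which $\begin{pmatrix}a&-q\,c^*\\c&a^*\end{pmatrix}$ is a matrix corepresentation. Put $X_z=\frac{1-K^4}{1-q^{-2}}$, $X_-=q^{-1/2}FK$, $X_+=q^{1/2}EK$. For $n\in\mathbb Z$ let $\mathcal L_n=\{x\in\mathcal A(\mathrm{SU}_q(2)):\alpha_z(x)=x\,(z^*)^n \text{ for all } z\in\mathrm U(1)\}$, where $\alpha_z$ is the algebra automorphism with $\alpha_z(a)=az$, $\alpha_z(c)=cz$, $\alpha_z(a^*)=a^*z^*$, $\alpha_z(c^*)=c^*z^*$, and let $\mathcal A(\mathbb{CP}^1_q)=\mathcal L_0$. Let $\Omega^1(\mathrm{SU}_q(2))$ be the free left module on $\beta_-,\beta_+,\beta_z$, with differential $\mathrm dx=(X_-\triangleright x)\beta_-+(X_+\triangleright x)\beta_++(X_z\triangleright x)\beta_z$, right module structure $\beta_\pm x=(K^2\triangleright x)\beta_\pm$, $\beta_z x=(K^4\triangleright x)\beta_z$, and wedge product with $\beta_\pm\wedge\beta_\pm=\beta_z\wedge\beta_z=0$, $\beta_+\wedge\beta_-=-q^2\beta_-\wedge\beta_+$,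 $\beta_z\wedge\beta_\mp=-q^{\pm4}\beta_\mp\wedge\beta_z$, two-forms being the free left module on $\beta_-\wedge\beta_+,\ \beta_-\wedge\beta_z,\ \beta_+\wedge\beta_z$. Let $\Pi_z$ be the left-linear projection with $\Pi_z(\beta_z)=\beta_z$, $\Pi_z(\beta_\pm)=0$. The calculus on $\mathbb{CP}^1_q$ is $\Omega^1=\mathcal L_{-2}\beta_-\oplus\mathcal L_2\beta_+$, $\Omega^2=\mathcal A(\mathbb{CP}^1_q)\,\beta_-\wedge\beta_+$, with $\mathrm df=(X_-\triangleright f)\beta_-+(X_+\triangleright f)\beta_+$ and $\mathrm d(x\beta_-+y\beta_+)=(X_-\triangleright y-q^2X_+\triangleright x)\,\beta_-\wedge\beta_+$. The canonical connection $\widehat\nabla_n:\mathcal L_n\to\mathcal L_n\otimes_{\mathcal A(\mathbb{CP}^1_q)}\Omega^1$ is $(\mathrm{id}-\Pi_z)\circ\mathrm d$, that is $\widehat\nabla_n\varphi=(X_+\triangleright\varphi)\beta_++(X_-\triangleright\varphi)\beta_-$, under the isomorphism $\mathcal L_n\otimes_{\mathcal A(\mathbb{CP}^1_q)}\Omega^1\simeq\mathcal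 L_{n-2}\beta_-\oplus\mathcal L_{n+2}\beta_+$, $\varphi\otimes\omega\mapsto\varphi\omega$. It is extended to $\mathcal L_n\otimes\Omega^1\to\mathcal L_n\otimes\Omega^2$ by $\widehat\nabla_n(\varphi\otimes\omega)=\widehat\nabla_n\varphi\wedge\omega+\varphi\otimes\mathrm d\omega$. Proposition. For every $n\in\mathbb Z$ and $\varphi\in\mathcal L_n$, the curvature $\widehat\nabla_n^2=\widehat\nabla_n\circ\widehat\nabla_n$ satisfies $$\widehat\nabla_n^2\varphi=(X_z\triangleright\varphi)\,\beta_-\wedge\beta_+ .$$ Moreover $\widehat\nabla_n^2$ is right $\mathcal A(\mathbb{CP}^1_q)$-linear and, as an element of $\mathrm{Hom}_{\mathcal A(\mathbb{CP}^1_q)}(\mathcal L_n,\mathcal L_n\otimes_{\mathcal A(\mathbb{CP}^1_q)}\Omega^2)$, $$\widehat\nabla_n^2=-q^{n+1}[n]\;\beta_-\wedge\beta_+,\qquad [n]=\frac{q^n-q^{-n}}{q-q^{-1}} .$$ -/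

import Mathlib

open scoped TensorProduct

set_option linter.unusedVariables false

noncomputable section

/-- The range `0 < q < 1` of the deformation parameter. -/
abbrev QParam : Type := Set.Ioo (0 : ℝ) 1

namespace QParam

/-- `q` as a complex scalar. -/
def val (q : QParam) : ℂ := ((q : ℝ) : ℂ)

/-- `q ^ (1/2)` as a complex scalar. -/
def sqrt (q : QParam) : ℂ := ((Real.sqrt (q : ℝ) : ℝ) : ℂ)

/-- The `q`-number `[n] = (q ^ n - q ^ (-n)) / (q - q⁻¹)`. -/
def number (q : QParam) (n : ℤ) : ℂ := (q.val ^ n - q.val ^ (-n)) / (q.val - q.val⁻¹)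

theorem val_ne_zero (q : QParam) : q.val ≠ 0 :=
  Complex.ofReal_ne_zero.mpr q.2.1.ne'

theorem sqrt_ne_zero (q : QParam) : q.sqrt ≠ 0 :=
  Complex.ofReal_ne_zero.mpr (Real.sqrt_pos.mpr q.2.1).ne'

theorem val_eq (q : QParam) : q.val = q.sqrt ^ 2 := by
  have h : (q : ℝ) = Real.sqrt (q : ℝ) ^ 2 := (Real.sq_sqrt q.2.1.le).symm
  unfold val sqrt
  exact_mod_cast h

theorem sub_inv_ne_zero (q : QParam) : q.val - q.val⁻¹ ≠ 0 := by
  have h0 := q.2.1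
  have h1 := q.2.2
  have h2 : (1 : ℝ) < (q : ℝ)⁻¹ := (one_lt_inv₀ h0).mpr h1
  have h : (q : ℝ) - (q : ℝ)⁻¹ ≠ 0 := by linarith
  unfold val
  exact_mod_cast h

end QParam

/-! ### The coordinate algebra of `SU_q(2)` -/

/-- The generators `a, c, a*, c*`. -/
inductive SUGen : Type
  | a
  | c
  | as
  | cs

/-- The defining relations of the coordinate algebra of `SU_q(2)`; the list is stable under the
involution, so that the `*`-algebra generated by `a, c` is the algebra generated by
`a, c, a*, c*` with these relations. -/
inductive SURel (q : QParam) : FreeAlgebra ℂ SUGen → FreeAlgebra ℂ SUGen → Prop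
  | a_c : SURel q (FreeAlgebra.ι ℂ SUGen.a * FreeAlgebra.ι ℂ SUGen.c)
      (q.val • (FreeAlgebra.ι ℂ SUGen.c * FreeAlgebra.ι ℂ SUGen.a))
  | cs_as : SURel q (FreeAlgebra.ι ℂ SUGen.cs * FreeAlgebra.ι ℂ SUGen.as)
      (q.val • (FreeAlgebra.ι ℂ SUGen.as * FreeAlgebra.ι ℂ SUGen.cs))
  | a_cs : SURel q (FreeAlgebra.ι ℂ SUGen.a * FreeAlgebra.ι ℂ SUGen.cs)
      (q.val • (FreeAlgebra.ι ℂ SUGen.cs * FreeAlgebra.ι ℂ SUGen.a))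
  | c_as : SURel q (FreeAlgebra.ι ℂ SUGen.c * FreeAlgebra.ι ℂ SUGen.as)
      (q.val • (FreeAlgebra.ι ℂ SUGen.as * FreeAlgebra.ι ℂ SUGen.c))
  | c_cs : SURel q (FreeAlgebra.ι ℂ SUGen.c * FreeAlgebra.ι ℂ SUGen.cs)
      (FreeAlgebra.ι ℂ SUGen.cs * FreeAlgebra.ι ℂ SUGen.c)
  | as_a : SURel q (FreeAlgebra.ι ℂ SUGen.as * FreeAlgebra.ι ℂ SUGen.a +
      FreeAlgebra.ι ℂ SUGen.cs * FreeAlgebra.ι ℂ SUGen.c) 1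
  | a_as : SURel q (FreeAlgebra.ι ℂ SUGen.a * FreeAlgebra.ι ℂ SUGen.as +
      q.val ^ 2 • (FreeAlgebra.ι ℂ SUGen.c * FreeAlgebra.ι ℂ SUGen.cs)) 1

/-- The coordinate algebra of `SU_q(2)`. -/
def ASU (q : QParam) : Type := RingQuot (SURel q)

namespace ASU

variable (q : QParam)

instance : Ring (ASU q) := inferInstanceAs (Ring (RingQuot (SURel q)))

instance : Algebra ℂ (ASU q) := inferInstanceAs (Algebra ℂ (RingQuot (SURel q)))

/-- The quotient map. -/
def mk : FreeAlgebra ℂ SUGen →ₐ[ℂ] ASU q := RingQuot.mkAlgHom ℂ (SURel q)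

/-- The class of a generator. -/
def gen (g : SUGen) : ASU q := mk q (FreeAlgebra.ι ℂ g)

theorem mk_rel {x y : FreeAlgebra ℂ SUGen} (h : SURel q x y) : mk q x = mk q y :=
  RingQuot.mkAlgHom_rel ℂ h

/-- The generator `a`. -/
def a : ASU q := gen q SUGen.a
/-- The generator `c`. -/
def c : ASU q := gen q SUGen.c
/-- The generator `a*`. -/
def as : ASU q := gen q SUGen.as
/-- The generator `c*`. -/
def cs : ASU q := gen q SUGen.cs

/-- Seven relations in an algebra `B` for images `A, C, As, Cs` of `a, c, a*, c*`. -/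
structure Rels {B : Type} [Ring B] [Algebra ℂ B] (A C As Cs : B) : Prop where
  a_c : A * C = q.val • (C * A)
  cs_as : Cs * As = q.val • (As * Cs)
  a_cs : A * Cs = q.val • (Cs * A)
  c_as : C * As = q.val • (As * C)
  c_cs : C * Cs = Cs * C
  as_a : As * A + Cs * C = 1
  a_as : A * As + q.val ^ 2 • (C * Cs) = 1

theorem rels : Rels q (a q) (c q) (as q) (cs q) := by
  constructor
  · simpa [a, c, gen] using mk_rel q SURel.a_c
  · simpa [as, cs, gen] using mk_rel q SURel.cs_as
  · simpa [a, cs, gen] using mk_rel q SURel.a_cs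
  · simpa [as, c, gen] using mk_rel q SURel.c_as
  · simpa [c, cs, gen] using mk_rel q SURel.c_cs
  · simpa [a, c, as, cs, gen] using mk_rel q SURel.as_a
  · simpa [a, c, as, cs, gen] using mk_rel q SURel.a_as

variable {q}

/-- The universal property of the coordinate algebra. -/
def lift {B : Type} [Ring B] [Algebra ℂ B] (A C As Cs : B) (h : Rels q A C As Cs) :
    ASU q →ₐ[ℂ] B :=
  RingQuot.liftAlgHom ℂ (s := SURel q)
    ⟨FreeAlgebra.lift ℂ fun g : SUGen => match g with
      | SUGen.a => A
      | SUGen.c => C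
      | SUGen.as => As
      | SUGen.cs => Cs, by
      intro x y hxy
      cases hxy
      · simpa using h.a_c
      · simpa using h.cs_as
      · simpa using h.a_cs
      · simpa using h.c_as
      · simpa using h.c_cs
      · simpa using h.as_a
      · simpa using h.a_as⟩

section
variable {B : Type} [Ring B] [Algebra ℂ B] (A C As Cs : B) (h : Rels q A C As Cs)

theorem lift_gen (g : SUGen) : lift A C As Cs h (gen q g) = match g with
      | SUGen.a => A
      | SUGen.c => C
      | SUGen.as => As
      | SUGen.cs => Cs :=
  (RingQuot.liftAlgHom_mkAlgHom_apply ℂ _ _ _).trans (FreeAlgebra.lift_ι_apply _ _)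

@[simp] theorem lift_a : lift A C As Cs h (a q) = A := lift_gen A C As Cs h SUGen.a
@[simp] theorem lift_c : lift A C As Cs h (c q) = C := lift_gen A C As Cs h SUGen.c
@[simp] theorem lift_as : lift A C As Cs h (as q) = As := lift_gen A C As Cs h SUGen.as
@[simp] theorem lift_cs : lift A C As Cs h (cs q) = Cs := lift_gen A C As Cs h SUGen.cs
end

theorem induction {P : ASU q → Prop} (halg : ∀ r : ℂ, P (algebraMap ℂ (ASU q) r))
    (ha : P (a q)) (hc : P (c q)) (has : P (as q)) (hcs : P (cs q))
    (hmul : ∀ x y, P x → P y → P (x * y)) (hadd : ∀ x y, P x → P y → P (x + y))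
    (x : ASU q) : P x := by
  obtain ⟨y, rfl⟩ := RingQuot.mkAlgHom_surjective ℂ (SURel q) x
  induction y using FreeAlgebra.induction with
  | grade0 r => rw [AlgHom.commutes]; exact halg r
  | grade1 g =>
    cases g
    · exact ha
    · exact hc
    · exact has
    · exact hcs
  | mul x y hx hy => rw [map_mul]; exact hmul _ _ hx hy
  | add x y hx hy => rw [map_add]; exact hadd _ _ hx hy

/-- A twisted derivation is determined by its values on the generators. -/
theorem skew_ext {S T : ASU q →ₗ[ℂ] ASU q} (f g : ASU q → ASU q)
    (hS : ∀ x y, S (x * y) = S x * f y + g x * S y)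
    (hT : ∀ x y, T (x * y) = T x * f y + g x * T y) (h1 : S 1 = T 1)
    (ha : S (a q) = T (a q)) (hc : S (c q) = T (c q)) (has : S (as q) = T (as q))
    (hcs : S (cs q) = T (cs q)) : S = T := by
  ext x
  induction x using induction with
  | halg r => rw [Algebra.algebraMap_eq_smul_one, map_smul, map_smul, h1]
  | ha => exact ha
  | hc => exact hc
  | has => exact has
  | hcs => exact hcs
  | hmul x y hx hy => rw [hS, hT, hx, hy]
  | hadd x y hx hy => rw [map_add, map_add, hx, hy]

theorem algHom_ext {B : Type} [Ring B] [Algebra ℂ B] {S T : ASU q →ₐ[ℂ] B}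
    (ha : S (a q) = T (a q)) (hc : S (c q) = T (c q)) (has : S (as q) = T (as q))
    (hcs : S (cs q) = T (cs q)) : S = T := by
  ext x
  induction x using induction with
  | halg r => rw [AlgHom.commutes, AlgHom.commutes]
  | ha => exact ha
  | hc => exact hc
  | has => exact has
  | hcs => exact hcs
  | hmul x y hx hy => rw [map_mul, map_mul, hx, hy]
  | hadd x y hx hy => rw [map_add, map_add, hx, hy]

/-! Normal ordering: `c`, then `c*`, then `a` or `a*`. -/

theorem a_c : a q * c q = q.val • (c q * a q) := (rels q).a_c
theorem a_cs : a q * cs q = q.val • (cs q * a q) := (rels q).a_cs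
theorem as_c : as q * c q = q.val⁻¹ • (c q * as q) := by
  rw [(rels q).c_as, smul_smul, inv_mul_cancel₀ q.val_ne_zero, one_smul]
theorem as_cs : as q * cs q = q.val⁻¹ • (cs q * as q) := by
  rw [(rels q).cs_as, smul_smul, inv_mul_cancel₀ q.val_ne_zero, one_smul]
theorem cs_c : cs q * c q = c q * cs q := (rels q).c_cs.symm
theorem as_a : as q * a q = 1 - c q * cs q := by
  rw [eq_sub_iff_add_eq, (rels q).c_cs]; exact (rels q).as_a
theorem a_as : a q * as q = 1 - q.val ^ 2 • (c q * cs q) := by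
  rw [eq_sub_iff_add_eq]; exact (rels q).a_as

/-! ### Coproduct and action of `U_q(su(2))` -/

variable (q)

/-- The coproduct: the matrix `(a, -q c* ; c, a*)` is a matrix corepresentation. -/
def comul : ASU q →ₐ[ℂ] ASU q ⊗[ℂ] ASU q :=
  lift (a q ⊗ₜ a q - q.val • (cs q ⊗ₜ c q)) (c q ⊗ₜ a q + as q ⊗ₜ c q)
    (as q ⊗ₜ as q - q.val • (c q ⊗ₜ cs q)) (a q ⊗ₜ cs q + cs q ⊗ₜ as q) (by
      have hq := q.val_ne_zero
      constructor <;>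
      · simp only [mul_add, add_mul, mul_sub, sub_mul, smul_mul_assoc, mul_smul_comm,
          Algebra.TensorProduct.tmul_mul_tmul, a_c, a_cs, as_c, as_cs, cs_c, as_a, a_as,
          TensorProduct.tmul_sub, TensorProduct.sub_tmul, TensorProduct.tmul_smul,
          ← TensorProduct.smul_tmul', Algebra.TensorProduct.one_def]
        match_scalars <;> field_simp <;> ring)

/-- The character `⟨K, ·⟩`. -/
def pairK : ASU q →ₐ[ℂ] ℂ :=
  lift (q.sqrt⁻¹) 0 q.sqrt 0 (by
    have hq := q.sqrt_ne_zero
    constructor <;> simp [hq])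

/-- The character `⟨K⁻¹, ·⟩`. -/
def pairKinv : ASU q →ₐ[ℂ] ℂ :=
  lift q.sqrt 0 (q.sqrt⁻¹) 0 (by
    have hq := q.sqrt_ne_zero
    constructor <;> simp [hq])

/-- The representation `x ↦ (⟨K⁻¹, x⟩, ⟨E, x⟩ ; 0, ⟨K, x⟩)`. Multiplicativity is the identity
`⟨E, x y⟩ = ⟨E, x⟩ ⟨K, y⟩ + ⟨K⁻¹, x⟩ ⟨E, y⟩` for `Δ(E) = E ⊗ K + K⁻¹ ⊗ E`. -/
def pairEMat : ASU q →ₐ[ℂ] Matrix (Fin 2) (Fin 2) ℂ :=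
  lift !![q.sqrt, 0; 0, q.sqrt⁻¹] !![0, 1; 0, 0] !![q.sqrt⁻¹, 0; 0, q.sqrt] 0 (by
    have hq := q.sqrt_ne_zero
    constructor <;> ext i j <;> fin_cases i <;> fin_cases j <;>
      simp [Matrix.mul_apply, Fin.sum_univ_two, hq, q.val_eq] <;> field_simp)

/-- The representation `x ↦ (⟨K⁻¹, x⟩, ⟨F, x⟩ ; 0, ⟨K, x⟩)`. Multiplicativity is the identity
`⟨F, x y⟩ = ⟨F, x⟩ ⟨K, y⟩ + ⟨K⁻¹, x⟩ ⟨F, y⟩` for `Δ(F) = F ⊗ K + K⁻¹ ⊗ F`. -/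
def pairFMat : ASU q →ₐ[ℂ] Matrix (Fin 2) (Fin 2) ℂ :=
  lift !![q.sqrt, 0; 0, q.sqrt⁻¹] 0 !![q.sqrt⁻¹, 0; 0, q.sqrt] !![0, -q.val⁻¹; 0, 0] (by
    have hq := q.sqrt_ne_zero
    constructor <;> ext i j <;> fin_cases i <;> fin_cases j <;>
      simp [Matrix.mul_apply, Fin.sum_univ_two, hq, q.val_eq] <;> field_simp)

theorem pairEMat_entries (x : ASU q) :
    pairEMat q x 0 0 = pairKinv q x ∧ pairEMat q x 1 1 = pairK q x ∧ pairEMat q x 1 0 = 0 := by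
  induction x using induction with
  | halg r => simp [Matrix.algebraMap_matrix_apply]
  | ha => simp [pairEMat, pairK, pairKinv]
  | hc => simp [pairEMat, pairK, pairKinv]
  | has => simp [pairEMat, pairK, pairKinv]
  | hcs => simp [pairEMat, pairK, pairKinv]
  | hmul x y hx hy => simp [Matrix.mul_apply, Fin.sum_univ_two, hx, hy]
  | hadd x y hx hy => simp [hx, hy]

theorem pairFMat_entries (x : ASU q) :
    pairFMat q x 0 0 = pairKinv q x ∧ pairFMat q x 1 1 = pairK q x ∧ pairFMat q x 1 0 = 0 := by
  induction x using induction with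
  | halg r => simp [Matrix.algebraMap_matrix_apply]
  | ha => simp [pairFMat, pairK, pairKinv]
  | hc => simp [pairFMat, pairK, pairKinv]
  | has => simp [pairFMat, pairK, pairKinv]
  | hcs => simp [pairFMat, pairK, pairKinv]
  | hmul x y hx hy => simp [Matrix.mul_apply, Fin.sum_univ_two, hx, hy]
  | hadd x y hx hy => simp [hx, hy]

/-- The functional `⟨E, ·⟩`. -/
def pairE : ASU q →ₗ[ℂ] ℂ := Matrix.entryLinearMap ℂ ℂ 0 1 ∘ₗ (pairEMat q).toLinearMap

/-- The functional `⟨F, ·⟩`. -/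
def pairF : ASU q →ₗ[ℂ] ℂ := Matrix.entryLinearMap ℂ ℂ 0 1 ∘ₗ (pairFMat q).toLinearMap

theorem pairE_mul (x y : ASU q) :
    pairE q (x * y) = pairE q x * pairK q y + pairKinv q x * pairE q y := by
  simp [pairE, Matrix.mul_apply, Fin.sum_univ_two, pairEMat_entries, add_comm]

theorem pairF_mul (x y : ASU q) :
    pairF q (x * y) = pairF q x * pairK q y + pairKinv q x * pairF q y := by
  simp [pairF, Matrix.mul_apply, Fin.sum_univ_two, pairFMat_entries, add_comm]

variable {q}

/-- The linear map `x ⊗ y ↦ f(y) x`. -/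
def slice (f : ASU q →ₗ[ℂ] ℂ) : ASU q ⊗[ℂ] ASU q →ₗ[ℂ] ASU q :=
  (TensorProduct.rid ℂ (ASU q)).toLinearMap ∘ₗ LinearMap.lTensor (ASU q) f

@[simp] theorem slice_tmul (f : ASU q →ₗ[ℂ] ℂ) (x y : ASU q) : slice f (x ⊗ₜ y) = f y • x := by
  simp [slice]

/-- The operator `x ↦ x₍₁₎ f(x₍₂₎)`. -/
def act (f : ASU q →ₗ[ℂ] ℂ) : ASU q →ₗ[ℂ] ASU q := slice f ∘ₗ (comul q).toLinearMap

theorem act_mul_of_skew (f k k' : ASU q →ₗ[ℂ] ℂ)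
    (h : ∀ x y, f (x * y) = f x * k y + k' x * f y) (x y : ASU q) :
    act f (x * y) = act f x * act k y + act k' x * act f y := by
  have key : ∀ u v : ASU q ⊗[ℂ] ASU q,
      slice f (u * v) = slice f u * slice k v + slice k' u * slice f v := by
    intro u v
    induction u using TensorProduct.induction_on with
    | zero => simp
    | add u₁ u₂ h₁ h₂ => simp only [add_mul, map_add, h₁, h₂]; abel
    | tmul a b =>
      induction v using TensorProduct.induction_on with
      | zero => simp
      | add v₁ v₂ h₁ h₂ => simp only [mul_add, map_add, h₁, h₂]; abel
      | tmul c d =>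
        simp only [Algebra.TensorProduct.tmul_mul_tmul, slice_tmul, h, smul_mul_smul_comm, add_smul]
  simp [act, key]

theorem act_mul_of_char (k : ASU q →ₐ[ℂ] ℂ) (x y : ASU q) :
    act k.toLinearMap (x * y) = act k.toLinearMap x * act k.toLinearMap y := by
  have key : ∀ u v : ASU q ⊗[ℂ] ASU q,
      slice k.toLinearMap (u * v) = slice k.toLinearMap u * slice k.toLinearMap v := by
    intro u v
    induction u using TensorProduct.induction_on with
    | zero => simp
    | add u₁ u₂ h₁ h₂ => simp only [add_mul, map_add, h₁, h₂]
    | tmul a b =>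
      induction v using TensorProduct.induction_on with
      | zero => simp
      | add v₁ v₂ h₁ h₂ => simp only [mul_add, map_add, h₁, h₂]
      | tmul c d =>
        simp only [Algebra.TensorProduct.tmul_mul_tmul, slice_tmul, AlgHom.toLinearMap_apply,
          map_mul, smul_mul_smul_comm]
  simp [act, key]

variable (q)

/-- The operator `K ▷`. -/
def opK : ASU q →ₗ[ℂ] ASU q := act (pairK q).toLinearMap
/-- The operator `K⁻¹ ▷`. -/
def opKinv : ASU q →ₗ[ℂ] ASU q := act (pairKinv q).toLinearMap
/-- The operator `E ▷`. -/
def opE : ASU q →ₗ[ℂ] ASU q := act (pairE q)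
/-- The operator `F ▷`. -/
def opF : ASU q →ₗ[ℂ] ASU q := act (pairF q)

variable {q}

theorem opK_mul (x y : ASU q) : opK q (x * y) = opK q x * opK q y := act_mul_of_char _ x y
theorem opKinv_mul (x y : ASU q) : opKinv q (x * y) = opKinv q x * opKinv q y :=
  act_mul_of_char _ x y
theorem opE_mul (x y : ASU q) : opE q (x * y) = opE q x * opK q y + opKinv q x * opE q y :=
  act_mul_of_skew _ _ _ (pairE_mul q) x y
theorem opF_mul (x y : ASU q) : opF q (x * y) = opF q x * opK q y + opKinv q x * opF q y :=
  act_mul_of_skew _ _ _ (pairF_mul q) x y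

theorem opK_one : opK q 1 = 1 := by
  simp [opK, act, Algebra.TensorProduct.one_def]
theorem opKinv_one : opKinv q 1 = 1 := by
  simp [opKinv, act, Algebra.TensorProduct.one_def]
theorem opE_one : opE q 1 = 0 := by
  simp [opE, act, Algebra.TensorProduct.one_def, pairE]
theorem opF_one : opF q 1 = 0 := by
  simp [opF, act, Algebra.TensorProduct.one_def, pairF]

@[simp] theorem opK_a : opK q (a q) = q.sqrt⁻¹ • a q := by simp [opK, act, comul, pairK]
@[simp] theorem opK_c : opK q (c q) = q.sqrt⁻¹ • c q := by simp [opK, act, comul, pairK]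
@[simp] theorem opK_as : opK q (as q) = q.sqrt • as q := by simp [opK, act, comul, pairK]
@[simp] theorem opK_cs : opK q (cs q) = q.sqrt • cs q := by simp [opK, act, comul, pairK]
@[simp] theorem opKinv_a : opKinv q (a q) = q.sqrt • a q := by
  simp [opKinv, act, comul, pairKinv]
@[simp] theorem opKinv_c : opKinv q (c q) = q.sqrt • c q := by
  simp [opKinv, act, comul, pairKinv]
@[simp] theorem opKinv_as : opKinv q (as q) = q.sqrt⁻¹ • as q := by
  simp [opKinv, act, comul, pairKinv]
@[simp] theorem opKinv_cs : opKinv q (cs q) = q.sqrt⁻¹ • cs q := by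
  simp [opKinv, act, comul, pairKinv]
@[simp] theorem opE_a : opE q (a q) = -(q.val • cs q) := by
  simp [opE, act, comul, pairE, pairEMat]
@[simp] theorem opE_c : opE q (c q) = as q := by simp [opE, act, comul, pairE, pairEMat]
@[simp] theorem opE_as : opE q (as q) = 0 := by simp [opE, act, comul, pairE, pairEMat]
@[simp] theorem opE_cs : opE q (cs q) = 0 := by simp [opE, act, comul, pairE, pairEMat]
@[simp] theorem opF_a : opF q (a q) = 0 := by simp [opF, act, comul, pairF, pairFMat]
@[simp] theorem opF_c : opF q (c q) = 0 := by simp [opF, act, comul, pairF, pairFMat]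
@[simp] theorem opF_as : opF q (as q) = c q := by
  simp [opF, act, comul, pairF, pairFMat, smul_smul, q.val_ne_zero]
@[simp] theorem opF_cs : opF q (cs q) = -(q.val⁻¹ • a q) := by
  simp [opF, act, comul, pairF, pairFMat]

/-- An algebra endomorphism is determined by its values on the generators. -/
theorem mul_ext {S T : ASU q →ₗ[ℂ] ASU q} (hS : ∀ x y, S (x * y) = S x * S y)
    (hT : ∀ x y, T (x * y) = T x * T y) (h1 : S 1 = T 1)
    (ha : S (a q) = T (a q)) (hc : S (c q) = T (c q)) (has : S (as q) = T (as q))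
    (hcs : S (cs q) = T (cs q)) : S = T := by
  ext x
  induction x using induction with
  | halg r => rw [Algebra.algebraMap_eq_smul_one, map_smul, map_smul, h1]
  | ha => exact ha
  | hc => exact hc
  | has => exact has
  | hcs => exact hcs
  | hmul x y hx hy => rw [hS, hT, hx, hy]
  | hadd x y hx hy => rw [map_add, map_add, hx, hy]

theorem opK_opKinv (x : ASU q) : opK q (opKinv q x) = x := by
  have h : opK q ∘ₗ opKinv q = LinearMap.id := by
    have hq := q.sqrt_ne_zero
    apply mul_ext <;> simp [opK_mul, opKinv_mul, opK_one, opKinv_one, smul_smul, hq]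
  exact LinearMap.congr_fun h x

theorem opKinv_opK (x : ASU q) : opKinv q (opK q x) = x := by
  have h : opKinv q ∘ₗ opK q = LinearMap.id := by
    have hq := q.sqrt_ne_zero
    apply mul_ext <;> simp [opK_mul, opKinv_mul, opK_one, opKinv_one, smul_smul, hq]
  exact LinearMap.congr_fun h x

theorem opK_opE (x : ASU q) : opK q (opE q x) = q.val • opE q (opK q x) := by
  have h : opK q ∘ₗ opE q = q.val • (opE q ∘ₗ opK q) := by
    have hq := q.sqrt_ne_zero
    apply skew_ext (fun y => opK q (opK q y)) (fun x => x)
    · intro x y; simp [opE_mul, opK_mul, opK_opKinv]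
    · intro x y; simp [opE_mul, opK_mul, opKinv_opK]
    · simp [opE_one, opK_one]
    all_goals simp [smul_smul, q.val_eq] <;> congr 1 <;> field_simp
  exact LinearMap.congr_fun h x

theorem opK_opF (x : ASU q) : opK q (opF q x) = q.val⁻¹ • opF q (opK q x) := by
  have h : opK q ∘ₗ opF q = q.val⁻¹ • (opF q ∘ₗ opK q) := by
    have hq := q.sqrt_ne_zero
    apply skew_ext (fun y => opK q (opK q y)) (fun x => x)
    · intro x y; simp [opF_mul, opK_mul, opK_opKinv]
    · intro x y; simp [opF_mul, opK_mul, opKinv_opK]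
    · simp [opF_one, opK_one]
    all_goals simp [smul_smul, q.val_eq] <;> congr 1 <;> field_simp
  exact LinearMap.congr_fun h x

theorem opKinv_opE (x : ASU q) : opKinv q (opE q x) = q.val⁻¹ • opE q (opKinv q x) := by
  have h := opK_opE (opKinv q x)
  rw [opK_opKinv] at h
  have h2 := congrArg (opKinv q) h
  rw [opKinv_opK, map_smul] at h2
  rw [h2, smul_smul, inv_mul_cancel₀ q.val_ne_zero, one_smul]

theorem opKinv_opF (x : ASU q) : opKinv q (opF q x) = q.val • opF q (opKinv q x) := by
  have h := opK_opF (opKinv q x)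
  rw [opK_opKinv] at h
  have h2 := congrArg (opKinv q) h
  rw [opKinv_opK, map_smul] at h2
  rw [h2, smul_smul, mul_inv_cancel₀ q.val_ne_zero, one_smul]

theorem opE_opF (x : ASU q) : opE q (opF q x) - opF q (opE q x) =
    (q.val - q.val⁻¹)⁻¹ • (opK q (opK q x) - opKinv q (opKinv q x)) := by
  have h : opE q ∘ₗ opF q - opF q ∘ₗ opE q =
      (q.val - q.val⁻¹)⁻¹ • (opK q ∘ₗ opK q - opKinv q ∘ₗ opKinv q) := by
    have hq := q.sqrt_ne_zero
    have hq1 := q.sub_inv_ne_zero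
    have hq2 : q.sqrt ^ 4 - 1 ≠ 0 := by
      intro h0
      apply hq1
      rw [q.val_eq]
      field_simp
      linear_combination h0
    apply skew_ext (fun y => opK q (opK q y)) (fun x => opKinv q (opKinv q x))
    · intro x y
      simp [opE_mul, opF_mul, opK_opE, opK_opF, opKinv_opE, opKinv_opF, sub_mul, mul_sub]
      match_scalars <;> field_simp [q.val_ne_zero] <;> ring
    · intro x y
      simp [opK_mul, opKinv_mul, sub_mul, mul_sub]
      match_scalars <;> ring
    · simp [opE_one, opF_one, opK_one, opKinv_one]
    all_goals
      simp [smul_smul, q.val_eq]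
      match_scalars
      field_simp
      try ring
  exact LinearMap.congr_fun h x

end ASU

/-! ### The quantum enveloping algebra `U_q(su(2))` -/

/-- The generators `K, K⁻¹, E, F`. -/
inductive UqGen : Type
  | K
  | Kinv
  | E
  | F

/-- The defining relations of `U_q(su(2))`. -/
inductive UqRel (q : QParam) : FreeAlgebra ℂ UqGen → FreeAlgebra ℂ UqGen → Prop
  | K_Kinv : UqRel q (FreeAlgebra.ι ℂ UqGen.K * FreeAlgebra.ι ℂ UqGen.Kinv) 1
  | Kinv_K : UqRel q (FreeAlgebra.ι ℂ UqGen.Kinv * FreeAlgebra.ι ℂ UqGen.K) 1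
  | K_E : UqRel q (FreeAlgebra.ι ℂ UqGen.K * FreeAlgebra.ι ℂ UqGen.E)
      (q.val • (FreeAlgebra.ι ℂ UqGen.E * FreeAlgebra.ι ℂ UqGen.K))
  | Kinv_E : UqRel q (FreeAlgebra.ι ℂ UqGen.Kinv * FreeAlgebra.ι ℂ UqGen.E)
      (q.val⁻¹ • (FreeAlgebra.ι ℂ UqGen.E * FreeAlgebra.ι ℂ UqGen.Kinv))
  | K_F : UqRel q (FreeAlgebra.ι ℂ UqGen.K * FreeAlgebra.ι ℂ UqGen.F)
      (q.val⁻¹ • (FreeAlgebra.ι ℂ UqGen.F * FreeAlgebra.ι ℂ UqGen.K))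
  | Kinv_F : UqRel q (FreeAlgebra.ι ℂ UqGen.Kinv * FreeAlgebra.ι ℂ UqGen.F)
      (q.val • (FreeAlgebra.ι ℂ UqGen.F * FreeAlgebra.ι ℂ UqGen.Kinv))
  | E_F : UqRel q (FreeAlgebra.ι ℂ UqGen.E * FreeAlgebra.ι ℂ UqGen.F -
        FreeAlgebra.ι ℂ UqGen.F * FreeAlgebra.ι ℂ UqGen.E)
      ((q.val - q.val⁻¹)⁻¹ •
        (FreeAlgebra.ι ℂ UqGen.K ^ 2 - FreeAlgebra.ι ℂ UqGen.Kinv ^ 2))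

/-- The algebra `U_q(su(2))`. -/
def Uq (q : QParam) : Type := RingQuot (UqRel q)

namespace Uq

variable (q : QParam)

instance : Ring (Uq q) := inferInstanceAs (Ring (RingQuot (UqRel q)))

instance : Algebra ℂ (Uq q) := inferInstanceAs (Algebra ℂ (RingQuot (UqRel q)))

/-- The quotient map. -/
def mk : FreeAlgebra ℂ UqGen →ₐ[ℂ] Uq q := RingQuot.mkAlgHom ℂ (UqRel q)

/-- The generator `K`. -/
def K : Uq q := mk q (FreeAlgebra.ι ℂ UqGen.K)
/-- The generator `K⁻¹`. -/
def Kinv : Uq q := mk q (FreeAlgebra.ι ℂ UqGen.Kinv)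
/-- The generator `E`. -/
def E : Uq q := mk q (FreeAlgebra.ι ℂ UqGen.E)
/-- The generator `F`. -/
def F : Uq q := mk q (FreeAlgebra.ι ℂ UqGen.F)

/-- The left action `h ▷ x = x₍₁₎ ⟨h, x₍₂₎⟩` of `U_q(su(2))` on the coordinate algebra of
`SU_q(2)`: the generators act by this formula, and `(g h) ▷ x = g ▷ (h ▷ x)`. -/
def action : Uq q →ₐ[ℂ] Module.End ℂ (ASU q) :=
  RingQuot.liftAlgHom ℂ (s := UqRel q)
    ⟨FreeAlgebra.lift ℂ fun g : UqGen => match g with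
      | UqGen.K => ASU.opK q
      | UqGen.Kinv => ASU.opKinv q
      | UqGen.E => ASU.opE q
      | UqGen.F => ASU.opF q, by
      intro x y hxy
      cases hxy <;> ext x
      · simp [ASU.opK_opKinv]
      · simp [ASU.opKinv_opK]
      · simp [ASU.opK_opE]
      · simp [ASU.opKinv_opE]
      · simp [ASU.opK_opF]
      · simp [ASU.opKinv_opF]
      · simp [ASU.opE_opF, pow_two]⟩

theorem action_gen (g : UqGen) : action q (mk q (FreeAlgebra.ι ℂ g)) = match g with
      | UqGen.K => ASU.opK q
      | UqGen.Kinv => ASU.opKinv q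
      | UqGen.E => ASU.opE q
      | UqGen.F => ASU.opF q :=
  (RingQuot.liftAlgHom_mkAlgHom_apply ℂ _ _ _).trans (FreeAlgebra.lift_ι_apply _ _)

@[simp] theorem action_K : action q (K q) = ASU.opK q := action_gen q UqGen.K
@[simp] theorem action_Kinv : action q (Kinv q) = ASU.opKinv q := action_gen q UqGen.Kinv
@[simp] theorem action_E : action q (E q) = ASU.opE q := action_gen q UqGen.E
@[simp] theorem action_F : action q (F q) = ASU.opF q := action_gen q UqGen.F

/-- `X_z = (1 - K ^ 4) / (1 - q ^ (-2))`. -/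
def Xz : Uq q := (1 - (q.val ^ 2)⁻¹)⁻¹ • (1 - K q ^ 4)

/-- `X_- = q ^ (-1/2) F K`. -/
def Xm : Uq q := q.sqrt⁻¹ • (F q * K q)

/-- `X_+ = q ^ (1/2) E K`. -/
def Xp : Uq q := q.sqrt • (E q * K q)

variable {q}

theorem action_Xz (x : ASU q) : action q (Xz q) x =
    (1 - (q.val ^ 2)⁻¹)⁻¹ • (x - ASU.opK q (ASU.opK q (ASU.opK q (ASU.opK q x)))) := by
  simp [Xz, pow_succ]

theorem action_Xm (x : ASU q) :
    action q (Xm q) x = q.sqrt⁻¹ • ASU.opF q (ASU.opK q x) := by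
  simp [Xm]

theorem action_Xp (x : ASU q) : action q (Xp q) x = q.sqrt • ASU.opE q (ASU.opK q x) := by
  simp [Xp]

theorem Xp_mul (x y : ASU q) : action q (Xp q) (x * y) =
    x * action q (Xp q) y + action q (Xp q) x * ASU.opK q (ASU.opK q y) := by
  simp [action_Xp, ASU.opK_mul, ASU.opE_mul, ASU.opKinv_opK, add_comm]

theorem Xm_mul (x y : ASU q) : action q (Xm q) (x * y) =
    x * action q (Xm q) y + action q (Xm q) x * ASU.opK q (ASU.opK q y) := by
  simp [action_Xm, ASU.opK_mul, ASU.opF_mul, ASU.opKinv_opK, add_comm]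

end Uq

/-! ### The `U(1)`-action, the line bundles and the quantum projective line -/

section LineBundles

variable (q : QParam)

/-- The `U(1)`-action `α_z` by algebra automorphisms, `α_z(a) = a z`, `α_z(c) = c z`,
`α_z(a*) = a* z*`, `α_z(c*) = c* z*`. -/
def alpha (z : Circle) : ASU q →ₐ[ℂ] ASU q :=
  ASU.lift ((z : ℂ) • ASU.a q) ((z : ℂ) • ASU.c q) (starRingEnd ℂ (z : ℂ) • ASU.as q)
    (starRingEnd ℂ (z : ℂ) • ASU.cs q) (by
      have hz : (z : ℂ) * starRingEnd ℂ (z : ℂ) = 1 := by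
        rw [Complex.mul_conj, Circle.normSq_coe, Complex.ofReal_one]
      have hz' : starRingEnd ℂ (z : ℂ) * (z : ℂ) = 1 := by rw [mul_comm, hz]
      constructor
      · rw [smul_mul_smul_comm, smul_mul_smul_comm, (ASU.rels q).a_c, smul_comm]
      · rw [smul_mul_smul_comm, smul_mul_smul_comm, (ASU.rels q).cs_as, smul_comm]
      · rw [smul_mul_smul_comm, smul_mul_smul_comm, (ASU.rels q).a_cs, hz, hz', smul_comm]
      · rw [smul_mul_smul_comm, smul_mul_smul_comm, (ASU.rels q).c_as, hz, hz', smul_comm]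
      · rw [smul_mul_smul_comm, smul_mul_smul_comm, (ASU.rels q).c_cs, hz, hz']
      · rw [smul_mul_smul_comm, smul_mul_smul_comm, hz', one_smul, one_smul, (ASU.rels q).as_a]
      · rw [smul_mul_smul_comm, smul_mul_smul_comm, hz, one_smul, one_smul, (ASU.rels q).a_as])

/-- The line bundle `L_n = {x | α_z(x) = x (z*) ^ n for all z in U(1)}`. -/
def LineBundle (n : ℤ) : Submodule ℂ (ASU q) where
  carrier := {x | ∀ z : Circle, alpha q z x = starRingEnd ℂ (z : ℂ) ^ n • x}
  add_mem' hx hy z := by rw [map_add, hx z, hy z, smul_add]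
  zero_mem' z := by rw [map_zero, smul_zero]
  smul_mem' r x hx z := by rw [map_smul, hx z, smul_comm]

/-- The coordinate algebra of the quantum projective line, the `U(1)`-invariant elements. -/
def Apq : Subalgebra ℂ (ASU q) where
  carrier := {x | ∀ z : Circle, alpha q z x = x}
  mul_mem' hx hy z := by rw [map_mul, hx z, hy z]
  add_mem' hx hy z := by rw [map_add, hx z, hy z]
  algebraMap_mem' r z := AlgHom.commutes _ r

variable {q}

theorem conj_circle_ne_zero (z : Circle) : starRingEnd ℂ (z : ℂ) ≠ 0 := by simp

theorem conj_circle_inv (z : Circle) : (starRingEnd ℂ (z : ℂ))⁻¹ = (z : ℂ) := by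
  rw [← Circle.coe_inv_eq_conj, Circle.coe_inv, inv_inv]

theorem mem_Apq_iff (x : ASU q) : x ∈ Apq q ↔ x ∈ LineBundle q 0 := by
  simp [Apq, LineBundle, ← SetLike.mem_coe]

theorem LineBundle.mul_mem {m n k : ℤ} (h : m + n = k) {x y : ASU q}
    (hx : x ∈ LineBundle q m) (hy : y ∈ LineBundle q n) : x * y ∈ LineBundle q k := by
  intro z
  rw [map_mul, hx z, hy z, smul_mul_smul_comm, ← zpow_add₀ (conj_circle_ne_zero z), h]

theorem LineBundle.mul_mem_Apq {m n : ℤ} (h : m + n = 0) {x y : ASU q}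
    (hx : x ∈ LineBundle q m) (hy : y ∈ LineBundle q n) : x * y ∈ Apq q :=
  (mem_Apq_iff _).mpr (LineBundle.mul_mem h hx hy)

theorem a_mem : ASU.a q ∈ LineBundle q (-1) := by
  intro z
  simp [alpha, conj_circle_inv]
theorem c_mem : ASU.c q ∈ LineBundle q (-1) := by
  intro z
  simp [alpha, conj_circle_inv]
theorem as_mem : ASU.as q ∈ LineBundle q 1 := by
  intro z
  simp [alpha]
theorem cs_mem : ASU.cs q ∈ LineBundle q 1 := by
  intro z
  simp [alpha]

theorem alpha_opK (z : Circle) (x : ASU q) :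
    alpha q z (ASU.opK q x) = ASU.opK q (alpha q z x) := by
  have h : (alpha q z).toLinearMap ∘ₗ ASU.opK q = ASU.opK q ∘ₗ (alpha q z).toLinearMap := by
    apply ASU.mul_ext <;> simp [ASU.opK_mul, ASU.opK_one, alpha, smul_smul, mul_comm]
  exact LinearMap.congr_fun h x

theorem alpha_opKinv (z : Circle) (x : ASU q) :
    alpha q z (ASU.opKinv q x) = ASU.opKinv q (alpha q z x) := by
  have h : (alpha q z).toLinearMap ∘ₗ ASU.opKinv q =
      ASU.opKinv q ∘ₗ (alpha q z).toLinearMap := by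
    apply ASU.mul_ext <;> simp [ASU.opKinv_mul, ASU.opKinv_one, alpha, smul_smul, mul_comm]
  exact LinearMap.congr_fun h x

theorem alpha_opE (z : Circle) (x : ASU q) :
    alpha q z (ASU.opE q x) = starRingEnd ℂ (z : ℂ) ^ 2 • ASU.opE q (alpha q z x) := by
  obtain ⟨w, hw⟩ : ∃ w, w = starRingEnd ℂ (z : ℂ) := ⟨_, rfl⟩
  have hw0 : w ≠ 0 := hw ▸ conj_circle_ne_zero z
  have hz' : (z : ℂ) = w⁻¹ := by rw [hw, conj_circle_inv]
  have h : (alpha q z).toLinearMap ∘ₗ ASU.opE q =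
      starRingEnd ℂ (z : ℂ) ^ 2 • (ASU.opE q ∘ₗ (alpha q z).toLinearMap) := by
    apply ASU.skew_ext (fun y => alpha q z (ASU.opK q y)) (fun y => alpha q z (ASU.opKinv q y))
    · intro x y; simp [ASU.opE_mul]
    · intro x y; simp [ASU.opE_mul, alpha_opK, alpha_opKinv]
    · simp [ASU.opE_one]
    all_goals
      simp [alpha, smul_smul]
      try simp only [← hw]
      try simp only [hz']
      try (match_scalars; field_simp)
  exact LinearMap.congr_fun h x

theorem alpha_opF (z : Circle) (x : ASU q) :
    alpha q z (ASU.opF q x) = starRingEnd ℂ (z : ℂ) ^ (-2 : ℤ) • ASU.opF q (alpha q z x) := by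
  obtain ⟨w, hw⟩ : ∃ w, w = starRingEnd ℂ (z : ℂ) := ⟨_, rfl⟩
  have hw0 : w ≠ 0 := hw ▸ conj_circle_ne_zero z
  have hz' : (z : ℂ) = w⁻¹ := by rw [hw, conj_circle_inv]
  have h : (alpha q z).toLinearMap ∘ₗ ASU.opF q =
      starRingEnd ℂ (z : ℂ) ^ (-2 : ℤ) • (ASU.opF q ∘ₗ (alpha q z).toLinearMap) := by
    apply ASU.skew_ext (fun y => alpha q z (ASU.opK q y)) (fun y => alpha q z (ASU.opKinv q y))
    · intro x y; simp [ASU.opF_mul]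
    · intro x y; simp [ASU.opF_mul, alpha_opK, alpha_opKinv]
    · simp [ASU.opF_one]
    all_goals
      simp [alpha, smul_smul]
      try simp only [← hw]
      try simp only [hz']
      try (match_scalars; field_simp)
  exact LinearMap.congr_fun h x

theorem opK_mem {n : ℤ} {x : ASU q} (hx : x ∈ LineBundle q n) : ASU.opK q x ∈ LineBundle q n := by
  intro z
  rw [alpha_opK, hx z, map_smul]

theorem Xz_mem {n : ℤ} {x : ASU q} (hx : x ∈ LineBundle q n) :
    Uq.action q (Uq.Xz q) x ∈ LineBundle q n := by
  rw [Uq.action_Xz]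
  exact Submodule.smul_mem _ _
    (Submodule.sub_mem _ hx (opK_mem (opK_mem (opK_mem (opK_mem hx)))))

theorem Xp_mem {n k : ℤ} (h : n + 2 = k) {x : ASU q} (hx : x ∈ LineBundle q n) :
    Uq.action q (Uq.Xp q) x ∈ LineBundle q k := by
  rw [Uq.action_Xp]
  refine Submodule.smul_mem _ _ fun z => ?_
  rw [alpha_opE, opK_mem hx z, map_smul, smul_smul, ← h, add_comm,
    zpow_add₀ (conj_circle_ne_zero z)]
  rfl

theorem Xm_mem {n k : ℤ} (h : n - 2 = k) {x : ASU q} (hx : x ∈ LineBundle q n) :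
    Uq.action q (Uq.Xm q) x ∈ LineBundle q k := by
  rw [Uq.action_Xm]
  refine Submodule.smul_mem _ _ fun z => ?_
  rw [alpha_opF, opK_mem hx z, map_smul, smul_smul, ← h, sub_eq_neg_add,
    zpow_add₀ (conj_circle_ne_zero z)]

/-- The right module structure of `L_n` over the coordinate algebra of the projective line. -/
instance (n : ℤ) : Module (Apq q)ᵐᵒᵖ (LineBundle q n) where
  smul f x := ⟨x.1 * f.unop.1,
    LineBundle.mul_mem (add_zero n) x.2 ((mem_Apq_iff _).mp f.unop.2)⟩
  one_smul x := Subtype.ext (mul_one x.1)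
  mul_smul f g x := Subtype.ext (mul_assoc x.1 g.unop.1 f.unop.1).symm
  smul_zero f := Subtype.ext (zero_mul f.unop.1)
  smul_add f x y := Subtype.ext (add_mul x.1 y.1 f.unop.1)
  add_smul f g x := Subtype.ext (mul_add x.1 f.unop.1 g.unop.1)
  zero_smul x := Subtype.ext (mul_zero x.1)

end LineBundles

/-! ### Forms on `SU_q(2)` -/

section Forms

variable (q : QParam)

/-- One-forms on `SU_q(2)`: the free left module with basis `β_-, β_+, β_z`; the triple
`(x, y, w)` is the form `x β_- + y β_+ + w β_z`. -/
def Form1 : Type := ASU q × ASU q × ASU q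

/-- Two-forms on `SU_q(2)`: the free left module with basis `β_- ∧ β_+, β_- ∧ β_z, β_+ ∧ β_z`. -/
def Form2 : Type := ASU q × ASU q × ASU q

instance : AddCommGroup (Form1 q) := inferInstanceAs (AddCommGroup (ASU q × ASU q × ASU q))
instance : Module ℂ (Form1 q) := inferInstanceAs (Module ℂ (ASU q × ASU q × ASU q))
instance : Module (ASU q) (Form1 q) := inferInstanceAs (Module (ASU q) (ASU q × ASU q × ASU q))
instance : AddCommGroup (Form2 q) := inferInstanceAs (AddCommGroup (ASU q × ASU q × ASU q))
instance : Module ℂ (Form2 q) := inferInstanceAs (Module ℂ (ASU q × ASU q × ASU q))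
instance : Module (ASU q) (Form2 q) := inferInstanceAs (Module (ASU q) (ASU q × ASU q × ASU q))

variable {q}

/-- The automorphism `K² ▷`, given on generators by `a ↦ q⁻¹ a`, `c ↦ q⁻¹ c`, `a* ↦ q a*`,
`c* ↦ q c*`; it describes the bimodule structure by `β_± x = (K² ▷ x) β_±` and
`β_z x = (K⁴ ▷ x) β_z`. -/
def twist : ASU q →ₗ[ℂ] ASU q := ASU.opK q ∘ₗ ASU.opK q

theorem twist_mul (x y : ASU q) : twist (x * y) = twist x * twist y := by
  simp [twist, ASU.opK_mul]

theorem twist_one : twist (1 : ASU q) = 1 := by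
  simp [twist, ASU.opK_one]

theorem twist_generators : twist (ASU.a q) = q.val⁻¹ • ASU.a q ∧
    twist (ASU.c q) = q.val⁻¹ • ASU.c q ∧ twist (ASU.as q) = q.val • ASU.as q ∧
    twist (ASU.cs q) = q.val • ASU.cs q := by
  simp [twist, smul_smul, q.val_eq, pow_two]

theorem twist_mem {n : ℤ} {x : ASU q} (hx : x ∈ LineBundle q n) : twist x ∈ LineBundle q n :=
  opK_mem (opK_mem hx)

theorem Form1.ext {ω η : Form1 q} (h1 : ω.1 = η.1) (h2 : ω.2.1 = η.2.1) (h3 : ω.2.2 = η.2.2) :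
    ω = η := Prod.ext h1 (Prod.ext h2 h3)

theorem Form2.ext {ω η : Form2 q} (h1 : ω.1 = η.1) (h2 : ω.2.1 = η.2.1) (h3 : ω.2.2 = η.2.2) :
    ω = η := Prod.ext h1 (Prod.ext h2 h3)

/-- The right module structure of the one-forms. -/
instance : Module (ASU q)ᵐᵒᵖ (Form1 q) where
  smul y ω := (ω.1 * twist y.unop, ω.2.1 * twist y.unop, ω.2.2 * twist (twist y.unop))
  one_smul ω := Form1.ext (by change _ * twist 1 = _; rw [twist_one, mul_one])
    (by change _ * twist 1 = _; rw [twist_one, mul_one])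
    (by change _ * twist (twist 1) = _; rw [twist_one, twist_one, mul_one])
  mul_smul f g ω := Form1.ext
    (by change _ * twist (g.unop * f.unop) = _; rw [twist_mul, ← mul_assoc]; rfl)
    (by change _ * twist (g.unop * f.unop) = _; rw [twist_mul, ← mul_assoc]; rfl)
    (by change _ * twist (twist (g.unop * f.unop)) = _
        rw [twist_mul, twist_mul, ← mul_assoc]; rfl)
  smul_zero f := Form1.ext (zero_mul _) (zero_mul _) (zero_mul _)
  smul_add f ω η := Form1.ext (add_mul _ _ _) (add_mul _ _ _) (add_mul _ _ _)
  add_smul f g ω := Form1.ext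
    (by change _ * twist (f.unop + g.unop) = _; rw [map_add, mul_add]; rfl)
    (by change _ * twist (f.unop + g.unop) = _; rw [map_add, mul_add]; rfl)
    (by change _ * twist (twist (f.unop + g.unop)) = _; rw [map_add, map_add, mul_add]; rfl)
  zero_smul ω := Form1.ext (by change _ * twist 0 = _; rw [map_zero, mul_zero]; rfl)
    (by change _ * twist 0 = _; rw [map_zero, mul_zero]; rfl)
    (by change _ * twist (twist 0) = _; rw [map_zero, map_zero, mul_zero]; rfl)

/-- The right module structure of the two-forms. -/
instance : Module (ASU q)ᵐᵒᵖ (Form2 q) where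
  smul y ω := (ω.1 * twist (twist y.unop), ω.2.1 * twist (twist (twist y.unop)),
    ω.2.2 * twist (twist (twist y.unop)))
  one_smul ω := Form2.ext (by change _ * twist (twist 1) = _; simp only [twist_one, mul_one])
    (by change _ * twist (twist (twist 1)) = _; simp only [twist_one, mul_one])
    (by change _ * twist (twist (twist 1)) = _; simp only [twist_one, mul_one])
  mul_smul f g ω := Form2.ext
    (by change _ * twist (twist (g.unop * f.unop)) = _
        simp only [twist_mul, ← mul_assoc]; rfl)
    (by change _ * twist (twist (twist (g.unop * f.unop))) = _
        simp only [twist_mul, ← mul_assoc]; rfl)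
    (by change _ * twist (twist (twist (g.unop * f.unop))) = _
        simp only [twist_mul, ← mul_assoc]; rfl)
  smul_zero f := Form2.ext (zero_mul _) (zero_mul _) (zero_mul _)
  smul_add f ω η := Form2.ext (add_mul _ _ _) (add_mul _ _ _) (add_mul _ _ _)
  add_smul f g ω := Form2.ext
    (by change _ * twist (twist (f.unop + g.unop)) = _; simp only [map_add, mul_add]; rfl)
    (by change _ * twist (twist (twist (f.unop + g.unop))) = _
        simp only [map_add, mul_add]; rfl)
    (by change _ * twist (twist (twist (f.unop + g.unop))) = _
        simp only [map_add, mul_add]; rfl)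
  zero_smul ω := Form2.ext
    (by change _ * twist (twist 0) = _; simp only [map_zero, mul_zero]; rfl)
    (by change _ * twist (twist (twist 0)) = _; simp only [map_zero, mul_zero]; rfl)
    (by change _ * twist (twist (twist 0)) = _; simp only [map_zero, mul_zero]; rfl)

/-- The form `x β_- + y β_+ + w β_z`. -/
def Form1.of (x y w : ASU q) : Form1 q := (x, y, w)

/-- The form `x β_- ∧ β_+ + y β_- ∧ β_z + w β_+ ∧ β_z`. -/
def Form2.of (x y w : ASU q) : Form2 q := (x, y, w)

variable (q) in
/-- The left-invariant one-form `β_-`. -/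
def betaM : Form1 q := Form1.of 1 0 0

variable (q) in
/-- The left-invariant one-form `β_+`. -/
def betaP : Form1 q := Form1.of 0 1 0

variable (q) in
/-- The left-invariant one-form `β_z`. -/
def betaZ : Form1 q := Form1.of 0 0 1

variable (q) in
/-- The differential `d x = (X_- ▷ x) β_- + (X_+ ▷ x) β_+ + (X_z ▷ x) β_z`. -/
def diff0 : ASU q →ₗ[ℂ] Form1 q :=
  (Uq.action q (Uq.Xm q)).prod ((Uq.action q (Uq.Xp q)).prod (Uq.action q (Uq.Xz q)))

variable (q) in
/-- The principal connection `Π_z`, the left module projection onto the vertical forms with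
`Π_z(β_z) = β_z` and `Π_z(β_±) = 0`. -/
def verticalProj : Form1 q →ₗ[ℂ] Form1 q where
  toFun ω := Form1.of 0 0 ω.2.2
  map_add' ω η := Form1.ext (add_zero _).symm (add_zero _).symm rfl
  map_smul' r ω := Form1.ext (smul_zero _).symm (smul_zero _).symm rfl

/-- The wedge product of one-forms, from the bimodule structure and the relations
`β_+ ∧ β_- = -q² β_- ∧ β_+`, `β_z ∧ β_- = -q⁴ β_- ∧ β_z`, `β_z ∧ β_+ = -q⁻⁴ β_+ ∧ β_z`,
`β_± ∧ β_± = β_z ∧ β_z = 0`. -/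
def wedge (ω η : Form1 q) : Form2 q := Form2.of
  (ω.1 * twist η.2.1 - q.val ^ 2 • (ω.2.1 * twist η.1))
  (ω.1 * twist η.2.2 - q.val ^ 4 • (ω.2.2 * twist (twist η.1)))
  (ω.2.1 * twist η.2.2 - (q.val ^ 4)⁻¹ • (ω.2.2 * twist (twist η.2.1)))

/-! ### The calculus on the quantum projective line -/

variable (q) in
/-- The forms `L_(n-2) β_- ⊕ L_(n+2) β_+`. -/
def HorForm1 (n : ℤ) : Submodule ℂ (Form1 q) where
  carrier := {ω | ω.1 ∈ LineBundle q (n - 2) ∧ ω.2.1 ∈ LineBundle q (n + 2) ∧ ω.2.2 = 0}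
  add_mem' {ω η} hω hη := ⟨add_mem hω.1 hη.1, add_mem hω.2.1 hη.2.1,
    (congrArg₂ (· + ·) hω.2.2 hη.2.2).trans (add_zero 0)⟩
  zero_mem' := ⟨zero_mem _, zero_mem _, rfl⟩
  smul_mem' r ω hω := ⟨Submodule.smul_mem _ r hω.1, Submodule.smul_mem _ r hω.2.1,
    (congrArg (r • ·) hω.2.2).trans (smul_zero r)⟩

variable (q) in
/-- One-forms on the projective line, `L_(-2) β_- ⊕ L_2 β_+`. -/
def FormP1 : Submodule ℂ (Form1 q) := HorForm1 q 0

variable (q) in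
/-- Two-forms on the projective line, `L_0 β_- ∧ β_+`. -/
def FormP2 : Submodule ℂ (Form2 q) where
  carrier := {ω | ω.1 ∈ Apq q ∧ ω.2.1 = 0 ∧ ω.2.2 = 0}
  add_mem' {ω η} hω hη := ⟨add_mem hω.1 hη.1,
    (congrArg₂ (· + ·) hω.2.1 hη.2.1).trans (add_zero 0),
    (congrArg₂ (· + ·) hω.2.2 hη.2.2).trans (add_zero 0)⟩
  zero_mem' := ⟨zero_mem _, rfl, rfl⟩
  smul_mem' r ω hω := ⟨Subalgebra.smul_mem _ hω.1 r,
    (congrArg (r • ·) hω.2.1).trans (smul_zero r), (congrArg (r • ·) hω.2.2).trans (smul_zero r)⟩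

theorem lineBundle_smul_mem {m n k : ℤ} (h : m + n = k) {x : ASU q} {ω : Form1 q}
    (hx : x ∈ LineBundle q m) (hω : ω ∈ HorForm1 q n) : x • ω ∈ HorForm1 q k :=
  ⟨LineBundle.mul_mem (by omega) hx hω.1, LineBundle.mul_mem (by omega) hx hω.2.1,
    (congrArg (x * ·) hω.2.2).trans (mul_zero x)⟩

theorem horForm1_op_smul_mem {n : ℤ} {x : ASU q} {ω : Form1 q}
    (hx : x ∈ Apq q) (hω : ω ∈ HorForm1 q n) : MulOpposite.op x • ω ∈ HorForm1 q n :=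
  ⟨LineBundle.mul_mem (add_zero _) hω.1 (twist_mem ((mem_Apq_iff _).mp hx)),
    LineBundle.mul_mem (add_zero _) hω.2.1 (twist_mem ((mem_Apq_iff _).mp hx)),
    (congrArg (· * twist (twist x)) hω.2.2).trans (zero_mul _)⟩

theorem formP2_smul_mem {x : ASU q} {ω : Form2 q} (hx : x ∈ Apq q) (hω : ω ∈ FormP2 q) :
    x • ω ∈ FormP2 q :=
  ⟨mul_mem hx hω.1, (congrArg (x * ·) hω.2.1).trans (mul_zero x),
    (congrArg (x * ·) hω.2.2).trans (mul_zero x)⟩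

theorem formP2_op_smul_mem {x : ASU q} {ω : Form2 q} (hx : x ∈ Apq q) (hω : ω ∈ FormP2 q) :
    MulOpposite.op x • ω ∈ FormP2 q :=
  ⟨mul_mem hω.1
      ((mem_Apq_iff _).mpr (twist_mem (twist_mem ((mem_Apq_iff _).mp hx)))),
    (congrArg (· * twist (twist (twist x))) hω.2.1).trans (zero_mul _),
    (congrArg (· * twist (twist (twist x))) hω.2.2).trans (zero_mul _)⟩

/-- Left multiplication of one-forms on the projective line by functions. -/
instance : Module (Apq q) (FormP1 q) where
  smul f ω := ⟨f.1 • ω.1, lineBundle_smul_mem (add_zero 0) ((mem_Apq_iff _).mp f.2) ω.2⟩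
  one_smul ω := Subtype.ext (one_smul (ASU q) ω.1)
  mul_smul f g ω := Subtype.ext (mul_smul f.1 g.1 ω.1)
  smul_zero f := Subtype.ext (smul_zero f.1)
  smul_add f ω η := Subtype.ext (smul_add f.1 ω.1 η.1)
  add_smul f g ω := Subtype.ext (add_smul f.1 g.1 ω.1)
  zero_smul ω := Subtype.ext (zero_smul (ASU q) ω.1)

/-- Right multiplication of one-forms on the projective line by functions. -/
instance : Module (Apq q)ᵐᵒᵖ (FormP1 q) where
  smul f ω := ⟨MulOpposite.op f.unop.1 • ω.1, horForm1_op_smul_mem f.unop.2 ω.2⟩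
  one_smul ω := Subtype.ext (one_smul (ASU q)ᵐᵒᵖ ω.1)
  mul_smul f g ω := Subtype.ext
    (mul_smul (MulOpposite.op f.unop.1) (MulOpposite.op g.unop.1) ω.1)
  smul_zero f := Subtype.ext (smul_zero (MulOpposite.op f.unop.1))
  smul_add f ω η := Subtype.ext (smul_add (MulOpposite.op f.unop.1) ω.1 η.1)
  add_smul f g ω := Subtype.ext
    (add_smul (MulOpposite.op f.unop.1) (MulOpposite.op g.unop.1) ω.1)
  zero_smul ω := Subtype.ext (zero_smul (ASU q)ᵐᵒᵖ ω.1)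

/-- Left multiplication of two-forms on the projective line by functions. -/
instance : Module (Apq q) (FormP2 q) where
  smul f ω := ⟨f.1 • ω.1, formP2_smul_mem f.2 ω.2⟩
  one_smul ω := Subtype.ext (one_smul (ASU q) ω.1)
  mul_smul f g ω := Subtype.ext (mul_smul f.1 g.1 ω.1)
  smul_zero f := Subtype.ext (smul_zero f.1)
  smul_add f ω η := Subtype.ext (smul_add f.1 ω.1 η.1)
  add_smul f g ω := Subtype.ext (add_smul f.1 g.1 ω.1)
  zero_smul ω := Subtype.ext (zero_smul (ASU q) ω.1)

/-- Right multiplication of two-forms on the projective line by functions. -/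
instance : Module (Apq q)ᵐᵒᵖ (FormP2 q) where
  smul f ω := ⟨MulOpposite.op f.unop.1 • ω.1, formP2_op_smul_mem f.unop.2 ω.2⟩
  one_smul ω := Subtype.ext (one_smul (ASU q)ᵐᵒᵖ ω.1)
  mul_smul f g ω := Subtype.ext
    (mul_smul (MulOpposite.op f.unop.1) (MulOpposite.op g.unop.1) ω.1)
  smul_zero f := Subtype.ext (smul_zero (MulOpposite.op f.unop.1))
  smul_add f ω η := Subtype.ext (smul_add (MulOpposite.op f.unop.1) ω.1 η.1)
  add_smul f g ω := Subtype.ext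
    (add_smul (MulOpposite.op f.unop.1) (MulOpposite.op g.unop.1) ω.1)
  zero_smul ω := Subtype.ext (zero_smul (ASU q)ᵐᵒᵖ ω.1)

instance : SMulCommClass (Apq q) (Apq q)ᵐᵒᵖ (FormP1 q) where
  smul_comm f g ω := Subtype.ext (Form1.ext (mul_assoc _ _ _).symm (mul_assoc _ _ _).symm
    (mul_assoc _ _ _).symm)

instance : SMulCommClass (Apq q) (Apq q)ᵐᵒᵖ (FormP2 q) where
  smul_comm f g ω := Subtype.ext (Form2.ext (mul_assoc _ _ _).symm (mul_assoc _ _ _).symm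
    (mul_assoc _ _ _).symm)

instance : SMulCommClass (Apq q)ᵐᵒᵖ ℂ (FormP1 q) where
  smul_comm f r ω := Subtype.ext (Form1.ext (smul_mul_assoc _ _ _) (smul_mul_assoc _ _ _)
    (smul_mul_assoc _ _ _))

instance : SMulCommClass (Apq q)ᵐᵒᵖ ℂ (FormP2 q) where
  smul_comm f r ω := Subtype.ext (Form2.ext (smul_mul_assoc _ _ _) (smul_mul_assoc _ _ _)
    (smul_mul_assoc _ _ _))

end Forms

/-! ### Tensor products over a noncommutative ring -/

section BalancedTensor

variable (R M N : Type) [Ring R] [AddCommGroup M] [Module ℂ M] [Module Rᵐᵒᵖ M]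
  [AddCommGroup N] [Module ℂ N] [Module R N]

/-- The relations `m r ⊗ n = m ⊗ r n`. -/
def balancedRel : Submodule ℂ (M ⊗[ℂ] N) :=
  Submodule.span ℂ {t | ∃ (m : M) (r : R) (n : N), t = (MulOpposite.op r • m) ⊗ₜ n - m ⊗ₜ (r • n)}

/-- The tensor product `M ⊗_R N` of a right module `M` and a left module `N` over an algebra `R`
over the complex numbers. -/
def BalTensor : Type := (M ⊗[ℂ] N) ⧸ balancedRel R M N

namespace BalTensor

instance : AddCommGroup (BalTensor R M N) :=
  inferInstanceAs (AddCommGroup ((M ⊗[ℂ] N) ⧸ balancedRel R M N))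
instance : Module ℂ (BalTensor R M N) :=
  inferInstanceAs (Module ℂ ((M ⊗[ℂ] N) ⧸ balancedRel R M N))

variable {M N}

/-- The pure tensor `m ⊗ n`, as a bilinear map. -/
def tmul : M →ₗ[ℂ] N →ₗ[ℂ] BalTensor R M N :=
  (TensorProduct.mk ℂ M N).compr₂ (balancedRel R M N).mkQ

variable {R}

theorem smul_tmul (r : R) (m : M) (n : N) :
    tmul R (MulOpposite.op r • m) n = tmul R m (r • n) :=
  (Submodule.Quotient.eq _).mpr (Submodule.subset_span ⟨m, r, n, rfl⟩)

theorem induction {P : BalTensor R M N → Prop} (h0 : P 0) (ht : ∀ m n, P (tmul R m n))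
    (ha : ∀ x y, P x → P y → P (x + y)) (x : BalTensor R M N) : P x := by
  obtain ⟨t, rfl⟩ := (balancedRel R M N).mkQ_surjective x
  induction t using TensorProduct.induction_on with
  | zero => rw [map_zero]; exact h0
  | tmul m n => exact ht m n
  | add x y hx hy => rw [map_add]; exact ha _ _ hx hy

/-- The universal property: a balanced bilinear map induces a linear map. -/
def lift {P : Type} [AddCommGroup P] [Module ℂ P] (B : M →ₗ[ℂ] N →ₗ[ℂ] P)
    (h : ∀ (r : R) (m : M) (n : N), B (MulOpposite.op r • m) n = B m (r • n)) :
    BalTensor R M N →ₗ[ℂ] P :=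
  (balancedRel R M N).liftQ (TensorProduct.lift B) (by
    refine Submodule.span_le.mpr ?_
    rintro _ ⟨m, r, n, rfl⟩
    simp [h])

@[simp] theorem lift_tmul {P : Type} [AddCommGroup P] [Module ℂ P] (B : M →ₗ[ℂ] N →ₗ[ℂ] P)
    (h : ∀ (r : R) (m : M) (n : N), B (MulOpposite.op r • m) n = B m (r • n)) (m : M) (n : N) :
    lift B h (tmul R m n) = B m n := rfl

theorem hom_ext {P : Type} [AddCommGroup P] [Module ℂ P] {S T : BalTensor R M N →ₗ[ℂ] P}
    (h : ∀ m n, S (tmul R m n) = T (tmul R m n)) : S = T := by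
  ext x
  induction x using induction with
  | h0 => rw [map_zero, map_zero]
  | ht m n => exact h m n
  | ha x y hx hy => rw [map_add, map_add, hx, hy]

/-- The map `id ⊗ g` for a left linear map `g`. -/
def lTensor {N' : Type} [AddCommGroup N'] [Module ℂ N'] [Module R N'] (g : N →ₗ[ℂ] N')
    (hg : ∀ (r : R) (n : N), g (r • n) = r • g n) : BalTensor R M N →ₗ[ℂ] BalTensor R M N' :=
  lift ((tmul R).compl₂ g) (by intro r m n; simp [hg, smul_tmul])

@[simp] theorem lTensor_tmul {N' : Type} [AddCommGroup N'] [Module ℂ N'] [Module R N']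
    (g : N →ₗ[ℂ] N') (hg : ∀ (r : R) (n : N), g (r • n) = r • g n) (m : M) (n : N) :
    lTensor g hg (tmul R m n) = tmul R m (g n) := rfl

variable [Module Rᵐᵒᵖ N] [SMulCommClass R Rᵐᵒᵖ N] [SMulCommClass Rᵐᵒᵖ ℂ N]

/-- Right multiplication `m ⊗ n ↦ m ⊗ n r`. -/
def rightMul (r : Rᵐᵒᵖ) : BalTensor R M N →ₗ[ℂ] BalTensor R M N :=
  lTensor (DistribSMul.toLinearMap ℂ N r) fun s n => (smul_comm s r n).symm

theorem rightMul_tmul (r : Rᵐᵒᵖ) (m : M) (n : N) :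
    rightMul r (tmul R m n) = tmul R m (r • n) := rfl

/-- The right module structure of `M ⊗_R N` for a bimodule `N`. -/
instance : Module Rᵐᵒᵖ (BalTensor R M N) where
  smul r x := rightMul r x
  one_smul x := by
    change rightMul 1 x = x
    induction x using induction with
    | h0 => rw [map_zero]
    | ht m n => simp only [rightMul_tmul, one_smul]
    | ha x y hx hy => rw [map_add, hx, hy]
  mul_smul r s x := by
    change rightMul (r * s) x = rightMul r (rightMul s x)
    induction x using induction with
    | h0 => simp only [map_zero]
    | ht m n => simp only [rightMul_tmul, mul_smul]
    | ha x y hx hy => simp only [map_add, hx, hy]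
  smul_zero r := map_zero (rightMul r)
  smul_add r := map_add (rightMul r)
  add_smul r s x := by
    change rightMul (r + s) x = rightMul r x + rightMul s x
    induction x using induction with
    | h0 => simp only [map_zero, add_zero]
    | ht m n => simp only [rightMul_tmul, add_smul, map_add]
    | ha x y hx hy => simp only [map_add, hx, hy]; abel
  zero_smul x := by
    change rightMul 0 x = 0
    induction x using induction with
    | h0 => rw [map_zero]
    | ht m n => simp only [rightMul_tmul, zero_smul, map_zero]
    | ha x y hx hy => rw [map_add, hx, hy, add_zero]

@[simp] theorem op_smul_tmul (r : Rᵐᵒᵖ) (m : M) (n : N) :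
    r • tmul R m n = tmul R m (r • n) := rfl

end BalTensor

end BalancedTensor

/-! ### The canonical connection and its curvature -/

section Connection

variable (q : QParam) (n : ℤ)

/-- `L_n ⊗ Ω¹` over the coordinate algebra of the projective line. -/
abbrev LForm1 : Type := BalTensor (Apq q) (LineBundle q n) (FormP1 q)

/-- `L_n ⊗ Ω²` over the coordinate algebra of the projective line. -/
abbrev LForm2 : Type := BalTensor (Apq q) (LineBundle q n) (FormP2 q)

variable {q}

/-- The multiplication map `L_n ⊗ Ω¹ → L_(n-2) β_- ⊕ L_(n+2) β_+`, `φ ⊗ ω ↦ φ ω`. -/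
def mulMap : LForm1 q n →ₗ[ℂ] HorForm1 q n :=
  BalTensor.lift
    (LinearMap.mk₂ ℂ
      (fun (φ : LineBundle q n) (ω : FormP1 q) =>
        (⟨φ.1 • ω.1, lineBundle_smul_mem (add_zero n) φ.2 ω.2⟩ : HorForm1 q n))
      (fun φ ψ ω => Subtype.ext (add_smul φ.1 ψ.1 ω.1))
      (fun r φ ω => Subtype.ext (Form1.ext (smul_mul_assoc _ _ _) (smul_mul_assoc _ _ _)
        (smul_mul_assoc _ _ _)))
      (fun φ ω η => Subtype.ext (smul_add φ.1 ω.1 η.1))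
      (fun r φ ω => Subtype.ext (Form1.ext (mul_smul_comm _ _ _) (mul_smul_comm _ _ _)
        (mul_smul_comm _ _ _))))
    (fun f φ ω => Subtype.ext (mul_smul φ.1 f.1 ω.1))

@[simp] theorem mulMap_tmul (φ : LineBundle q n) (ω : FormP1 q) :
    (mulMap n (BalTensor.tmul (Apq q) φ ω)).1 = φ.1 • ω.1 := rfl

/-! The partitions of unity `Σ v_i u_i = 1` used to invert the multiplication map. -/

/-- Elements of `L_2`. -/
def gensP : Fin 2 → Fin 2 → LineBundle q 2 := fun i j =>
  ⟨![ASU.as q, ASU.cs q] j * ![ASU.as q, ASU.cs q] i, by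
    fin_cases i <;> fin_cases j <;>
      exact LineBundle.mul_mem (m := 1) (n := 1) (by norm_num) (by first | exact as_mem | exact cs_mem)
        (by first | exact as_mem | exact cs_mem)⟩

/-- Elements of `L_(-2)`. -/
def gensM : Fin 2 → Fin 2 → LineBundle q (-2) := fun i j =>
  ⟨![ASU.a q, ASU.c q] i * ![ASU.a q, ASU.c q] j, by
    fin_cases i <;> fin_cases j <;>
      exact LineBundle.mul_mem (m := -1) (n := -1) (by norm_num) (by first | exact a_mem | exact c_mem)
        (by first | exact a_mem | exact c_mem)⟩

variable (q) in
/-- The coefficients `1, q²`. -/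
def coefP : Fin 2 → ℂ := ![1, q.val ^ 2]

theorem partition_one : ∑ i, coefP q i • (![ASU.a q, ASU.c q] i * ![ASU.as q, ASU.cs q] i) = 1 := by
  simpa [coefP, Fin.sum_univ_two] using (ASU.rels q).a_as

theorem partition_one' : ∑ i, ![ASU.as q, ASU.cs q] i * ![ASU.a q, ASU.c q] i = 1 := by
  simpa [Fin.sum_univ_two] using (ASU.rels q).as_a

theorem partition_MP : ∑ i, ∑ j,
    (coefP q i * coefP q j) • ((gensM (q := q) i j).1 * (gensP (q := q) i j).1) = 1 := by
  have h : ∀ i, ∑ j, (coefP q i * coefP q j) • ((gensM (q := q) i j).1 * (gensP (q := q) i j).1) =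
      coefP q i • (![ASU.a q, ASU.c q] i * ![ASU.as q, ASU.cs q] i) := by
    intro i
    calc _ = coefP q i • (![ASU.a q, ASU.c q] i *
          (∑ j, coefP q j • (![ASU.a q, ASU.c q] j * ![ASU.as q, ASU.cs q] j)) *
          ![ASU.as q, ASU.cs q] i) := by
          simp only [gensM, gensP, Finset.mul_sum, Finset.sum_mul, Finset.smul_sum, smul_smul,
            mul_smul_comm, smul_mul_assoc, mul_assoc]
      _ = _ := by rw [partition_one, mul_one]
  simp only [h, partition_one]

theorem partition_PM : ∑ i, ∑ j, (gensP (q := q) i j).1 * (gensM (q := q) i j).1 = 1 := by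
  have h : ∀ j, ∑ i, (gensP (q := q) i j).1 * (gensM (q := q) i j).1 =
      ![ASU.as q, ASU.cs q] j * ![ASU.a q, ASU.c q] j := by
    intro j
    calc _ = ![ASU.as q, ASU.cs q] j * (∑ i, ![ASU.as q, ASU.cs q] i * ![ASU.a q, ASU.c q] i) *
          ![ASU.a q, ASU.c q] j := by
          simp only [gensM, gensP, Finset.mul_sum, Finset.sum_mul, mul_assoc]
      _ = _ := by rw [partition_one', mul_one]
  rw [Finset.sum_comm]
  simp only [h, partition_one']

/-- Right multiplication by an element of another line bundle. -/
def mulRight {m k l : ℤ} (h : m + k = l) (v : LineBundle q k) :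
    LineBundle q m →ₗ[ℂ] LineBundle q l where
  toFun x := ⟨x.1 * v.1, LineBundle.mul_mem h x.2 v.2⟩
  map_add' x y := Subtype.ext (add_mul x.1 y.1 v.1)
  map_smul' r x := Subtype.ext (smul_mul_assoc r x.1 v.1)

/-- The form `x β_-` for `x` in `L_(-2)`. -/
def formM (x : LineBundle q (-2)) : FormP1 q := ⟨Form1.of x.1 0 0, x.2, zero_mem _, rfl⟩

/-- The form `x β_+` for `x` in `L_2`. -/
def formP (x : LineBundle q 2) : FormP1 q := ⟨Form1.of 0 x.1 0, zero_mem _, x.2, rfl⟩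

/-- The inverse of the multiplication map. -/
def invMap : HorForm1 q n →ₗ[ℂ] LForm1 q n :=
  (∑ i, ∑ j, (BalTensor.tmul (Apq q)).flip (formM (gensM i j)) ∘ₗ
      mulRight (by omega : n - 2 + 2 = n) (gensP i j)) ∘ₗ
    LinearMap.codRestrict (LineBundle q (n - 2))
      (LinearMap.fst ℂ (ASU q) (ASU q × ASU q) ∘ₗ (HorForm1 q n).subtype) (fun ω => ω.2.1) +
  (∑ i, ∑ j, (coefP q i * coefP q j) • ((BalTensor.tmul (Apq q)).flip (formP (gensP i j)) ∘ₗ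
      mulRight (by omega : n + 2 + -2 = n) (gensM i j))) ∘ₗ
    LinearMap.codRestrict (LineBundle q (n + 2))
      (LinearMap.fst ℂ (ASU q) (ASU q) ∘ₗ LinearMap.snd ℂ (ASU q) (ASU q × ASU q) ∘ₗ
        (HorForm1 q n).subtype) (fun ω => ω.2.2.1)

theorem invMap_apply (ω : HorForm1 q n) : invMap n ω =
    ∑ i, ∑ j, BalTensor.tmul (Apq q)
      (⟨ω.1.1 * (gensP (q := q) i j).1, LineBundle.mul_mem (by omega) ω.2.1 (gensP i j).2⟩ :
        LineBundle q n) (formM (gensM i j)) +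
    ∑ i, ∑ j, (coefP q i * coefP q j) • BalTensor.tmul (Apq q)
      (⟨ω.1.2.1 * (gensM (q := q) i j).1, LineBundle.mul_mem (by omega) ω.2.2.1 (gensM i j).2⟩ :
        LineBundle q n) (formP (gensP i j)) := by
  simp only [invMap, LinearMap.add_apply, LinearMap.comp_apply, LinearMap.sum_apply,
    LinearMap.smul_apply]
  rfl

/-- The coefficient of `β_-`. -/
def FormP1.comp1 : FormP1 q →ₗ[ℂ] ASU q :=
  LinearMap.fst ℂ (ASU q) (ASU q × ASU q) ∘ₗ (FormP1 q).subtype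

/-- The coefficient of `β_+`. -/
def FormP1.comp2 : FormP1 q →ₗ[ℂ] ASU q :=
  LinearMap.fst ℂ (ASU q) (ASU q) ∘ₗ LinearMap.snd ℂ (ASU q) (ASU q × ASU q) ∘ₗ
    (FormP1 q).subtype

theorem FormP1.comp1_apply (ω : FormP1 q) : FormP1.comp1 ω = ω.1.1 := rfl
theorem FormP1.comp1_formM (f : Apq q) (x : LineBundle q (-2)) :
    FormP1.comp1 (f • formM x) = f.1 * x.1 := rfl
theorem FormP1.comp1_formP (f : Apq q) (x : LineBundle q 2) :
    FormP1.comp1 (f • formP x) = 0 := mul_zero f.1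
theorem FormP1.comp2_apply (ω : FormP1 q) : FormP1.comp2 ω = ω.1.2.1 := rfl
theorem FormP1.comp2_formM (f : Apq q) (x : LineBundle q (-2)) :
    FormP1.comp2 (f • formM x) = 0 := mul_zero f.1
theorem FormP1.comp2_formP (f : Apq q) (x : LineBundle q 2) :
    FormP1.comp2 (f • formP x) = f.1 * x.1 := rfl

/-- The coefficient of `β_-`. -/
def HorForm1.comp1 : HorForm1 q n →ₗ[ℂ] ASU q :=
  LinearMap.fst ℂ (ASU q) (ASU q × ASU q) ∘ₗ (HorForm1 q n).subtype

/-- The coefficient of `β_+`. -/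
def HorForm1.comp2 : HorForm1 q n →ₗ[ℂ] ASU q :=
  LinearMap.fst ℂ (ASU q) (ASU q) ∘ₗ LinearMap.snd ℂ (ASU q) (ASU q × ASU q) ∘ₗ
    (HorForm1 q n).subtype

theorem HorForm1.comp1_apply (ω : HorForm1 q n) : HorForm1.comp1 n ω = ω.1.1 := rfl
theorem HorForm1.comp1_formM (φ : LineBundle q n) (x : LineBundle q (-2)) :
    HorForm1.comp1 n (mulMap n (BalTensor.tmul (Apq q) φ (formM x))) = φ.1 * x.1 := rfl
theorem HorForm1.comp1_formP (φ : LineBundle q n) (x : LineBundle q 2) :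
    HorForm1.comp1 n (mulMap n (BalTensor.tmul (Apq q) φ (formP x))) = 0 := mul_zero φ.1
theorem HorForm1.comp2_apply (ω : HorForm1 q n) : HorForm1.comp2 n ω = ω.1.2.1 := rfl
theorem HorForm1.comp2_formM (φ : LineBundle q n) (x : LineBundle q (-2)) :
    HorForm1.comp2 n (mulMap n (BalTensor.tmul (Apq q) φ (formM x))) = 0 := mul_zero φ.1
theorem HorForm1.comp2_formP (φ : LineBundle q n) (x : LineBundle q 2) :
    HorForm1.comp2 n (mulMap n (BalTensor.tmul (Apq q) φ (formP x))) = φ.1 * x.1 := rfl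

theorem wedge_add_left (ω ω' η : Form1 q) : wedge (ω + ω') η = wedge ω η + wedge ω' η := by
  have key : ∀ (r : ℂ) (x x' y y' s t : ASU q), (x + x') * s - r • ((y + y') * t) =
      (x * s - r • (y * t)) + (x' * s - r • (y' * t)) := by
    intros; simp only [add_mul, smul_add]; abel
  exact Form2.ext (key _ _ _ _ _ _ _) (key _ _ _ _ _ _ _) (key _ _ _ _ _ _ _)

theorem wedge_smul_left (c : ℂ) (ω η : Form1 q) : wedge (c • ω) η = c • wedge ω η := by
  have key : ∀ (r : ℂ) (x y s t : ASU q), (c • x) * s - r • ((c • y) * t) =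
      c • (x * s - r • (y * t)) := by
    intros; simp only [smul_mul_assoc, smul_sub]; rw [smul_comm c]
  exact Form2.ext (key _ _ _ _ _) (key _ _ _ _ _) (key _ _ _ _ _)

theorem wedge_add_right (ω η η' : Form1 q) : wedge ω (η + η') = wedge ω η + wedge ω η' := by
  have key : ∀ (r : ℂ) (S T : ASU q →ₗ[ℂ] ASU q) (x y s s' t t' : ASU q),
      x * S (s + s') - r • (y * T (t + t')) =
      (x * S s - r • (y * T t)) + (x * S s' - r • (y * T t')) := by
    intros; simp only [map_add, mul_add, smul_add]; abel
  exact Form2.ext (key _ twist twist _ _ _ _ _ _) (key _ twist (twist ∘ₗ twist) _ _ _ _ _ _)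
    (key _ twist (twist ∘ₗ twist) _ _ _ _ _ _)

theorem wedge_smul_right (c : ℂ) (ω η : Form1 q) : wedge ω (c • η) = c • wedge ω η := by
  have key : ∀ (r : ℂ) (S T : ASU q →ₗ[ℂ] ASU q) (x y s t : ASU q),
      x * S (c • s) - r • (y * T (c • t)) = c • (x * S s - r • (y * T t)) := by
    intros; simp only [map_smul, mul_smul_comm, smul_sub]; rw [smul_comm c]
  exact Form2.ext (key _ twist twist _ _ _ _) (key _ twist (twist ∘ₗ twist) _ _ _ _)
    (key _ twist (twist ∘ₗ twist) _ _ _ _)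

theorem wedge_asu_smul_left (f : ASU q) (ω η : Form1 q) : wedge (f • ω) η = f • wedge ω η := by
  have key : ∀ (r : ℂ) (x y s t : ASU q), (f * x) * s - r • ((f * y) * t) =
      f * (x * s - r • (y * t)) := by
    intros; rw [mul_sub, mul_smul_comm, mul_assoc, mul_assoc]
  exact Form2.ext (key _ _ _ _ _) (key _ _ _ _ _) (key _ _ _ _ _)

theorem wedge_balanced (f : ASU q) (ω η : Form1 q) :
    wedge (MulOpposite.op f • ω) η = wedge ω (f • η) := by
  refine Form2.ext ?_ ?_ ?_
  · change (ω.1 * twist f) * twist η.2.1 - q.val ^ 2 • ((ω.2.1 * twist f) * twist η.1) =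
      ω.1 * twist (f * η.2.1) - q.val ^ 2 • (ω.2.1 * twist (f * η.1))
    simp only [twist_mul, mul_assoc]
  · change (ω.1 * twist f) * twist η.2.2 -
        q.val ^ 4 • ((ω.2.2 * twist (twist f)) * twist (twist η.1)) =
      ω.1 * twist (f * η.2.2) - q.val ^ 4 • (ω.2.2 * twist (twist (f * η.1)))
    simp only [twist_mul, mul_assoc]
  · change (ω.2.1 * twist f) * twist η.2.2 -
        (q.val ^ 4)⁻¹ • ((ω.2.2 * twist (twist f)) * twist (twist η.2.1)) =
      ω.2.1 * twist (f * η.2.2) - (q.val ^ 4)⁻¹ • (ω.2.2 * twist (twist (f * η.2.1)))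
    simp only [twist_mul, mul_assoc]

theorem invMap_mulMap (x : LForm1 q n) : invMap n (mulMap n x) = x := by
  induction x using BalTensor.induction with
  | h0 => rw [map_zero, map_zero]
  | ha x y hx hy => rw [map_add, map_add, hx, hy]
  | ht φ ω =>
    obtain ⟨ω, h1, h2, h3⟩ := ω
    have e1 : ∀ i j, BalTensor.tmul (Apq q)
        (⟨(φ.1 * ω.1) * (gensP (q := q) i j).1,
          LineBundle.mul_mem (by omega : n - 2 + 2 = n)
            (LineBundle.mul_mem (by omega) φ.2 h1) (gensP i j).2⟩ : LineBundle q n)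
          (formM (gensM i j)) =
        BalTensor.tmul (Apq q) φ
          ((⟨ω.1 * (gensP (q := q) i j).1, LineBundle.mul_mem_Apq (by norm_num) h1
            (gensP i j).2⟩ : Apq q) • formM (q := q) (gensM i j)) := by
      intro i j
      rw [← BalTensor.smul_tmul]
      congr 2
      exact Subtype.ext (mul_assoc _ _ _)
    have e2 : ∀ i j, BalTensor.tmul (Apq q)
        (⟨(φ.1 * ω.2.1) * (gensM (q := q) i j).1,
          LineBundle.mul_mem (by omega : n + 2 + -2 = n)
            (LineBundle.mul_mem (by omega) φ.2 h2) (gensM i j).2⟩ : LineBundle q n)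
          (formP (gensP i j)) =
        BalTensor.tmul (Apq q) φ
          ((⟨ω.2.1 * (gensM (q := q) i j).1, LineBundle.mul_mem_Apq (by norm_num) h2
            (gensM i j).2⟩ : Apq q) • formP (q := q) (gensP i j)) := by
      intro i j
      rw [← BalTensor.smul_tmul]
      congr 2
      exact Subtype.ext (mul_assoc _ _ _)
    rw [invMap_apply]
    refine (congrArg₂ (· + ·)
      (Finset.sum_congr rfl fun i _ => Finset.sum_congr rfl fun j _ => e1 i j)
      (Finset.sum_congr rfl fun i _ => Finset.sum_congr rfl fun j _ =>
        congrArg _ (e2 i j))).trans ?_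
    simp only [← map_smul, ← map_sum, ← map_add]
    congr 1
    apply Subtype.ext
    have p1 : ∑ i, ∑ j, ω.1 * (gensP (q := q) i j).1 * (gensM (q := q) i j).1 = ω.1 := by
      have := congrArg (ω.1 * ·) (partition_PM (q := q))
      simpa only [Finset.mul_sum, mul_one, mul_assoc] using this
    have p2 : ∑ i, ∑ j, (coefP q i * coefP q j) •
        (ω.2.1 * (gensM (q := q) i j).1 * (gensP (q := q) i j).1) = ω.2.1 := by
      have := congrArg (ω.2.1 * ·) (partition_MP (q := q))
      simpa only [Finset.mul_sum, mul_one, mul_assoc, mul_smul_comm] using this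
    refine Form1.ext ?_ ?_ ?_
    · refine (FormP1.comp1_apply _).symm.trans ?_
      simp only [map_add, map_sum, map_smul, FormP1.comp1_formM, FormP1.comp1_formP, smul_zero,
        Finset.sum_const_zero, add_zero]
      exact p1
    · refine (FormP1.comp2_apply _).symm.trans ?_
      simp only [map_add, map_sum, map_smul, FormP1.comp2_formM, FormP1.comp2_formP,
        Finset.sum_const_zero, zero_add]
      exact p2
    · exact (Subtype.prop (_ : FormP1 q)).2.2.trans h3.symm

theorem mulMap_invMap (ω : HorForm1 q n) : mulMap n (invMap n ω) = ω := by
  obtain ⟨ω, h1, h2, h3⟩ := ω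
  have p1 : ∑ i, ∑ j, ω.1 * (gensP (q := q) i j).1 * (gensM (q := q) i j).1 = ω.1 := by
    have := congrArg (ω.1 * ·) (partition_PM (q := q))
    simpa only [Finset.mul_sum, mul_one, mul_assoc] using this
  have p2 : ∑ i, ∑ j, (coefP q i * coefP q j) •
      (ω.2.1 * (gensM (q := q) i j).1 * (gensP (q := q) i j).1) = ω.2.1 := by
    have := congrArg (ω.2.1 * ·) (partition_MP (q := q))
    simpa only [Finset.mul_sum, mul_one, mul_assoc, mul_smul_comm] using this
  rw [invMap_apply]
  apply Subtype.ext
  refine Form1.ext ?_ ?_ ?_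
  · refine (HorForm1.comp1_apply n _).symm.trans ?_
    simp only [map_add, map_sum, map_smul, HorForm1.comp1_formM, HorForm1.comp1_formP, smul_zero,
      Finset.sum_const_zero, add_zero]
    exact p1
  · refine (HorForm1.comp2_apply n _).symm.trans ?_
    simp only [map_add, map_sum, map_smul, HorForm1.comp2_formM, HorForm1.comp2_formP,
      Finset.sum_const_zero, zero_add]
    exact p2
  · exact (Subtype.prop (_ : HorForm1 q n)).2.2.trans h3.symm

variable (q) in
/-- The isomorphism `L_n ⊗ Ω¹ ≃ L_(n-2) β_- ⊕ L_(n+2) β_+`, `φ ⊗ ω ↦ φ ω`. -/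
def mulEquiv : LForm1 q n ≃ₗ[ℂ] HorForm1 q n :=
  LinearEquiv.ofLinearMap (mulMap n) (invMap n) (LinearMap.ext (mulMap_invMap n))
    (LinearMap.ext (invMap_mulMap n))

variable (q) in
/-- The map `(id - Π_z) ∘ d` on `L_n`; it equals
`φ ↦ (X_- ▷ φ) β_- + (X_+ ▷ φ) β_+`. -/
def horDiff : LineBundle q n →ₗ[ℂ] HorForm1 q n :=
  LinearMap.codRestrict (HorForm1 q n)
    ((LinearMap.id - verticalProj q) ∘ₗ diff0 q ∘ₗ (LineBundle q n).subtype)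
    (fun φ => ⟨by
        change Uq.action q (Uq.Xm q) φ.1 - 0 ∈ _
        rw [sub_zero]; exact Xm_mem rfl φ.2, by
        change Uq.action q (Uq.Xp q) φ.1 - 0 ∈ _
        rw [sub_zero]; exact Xp_mem rfl φ.2,
      sub_self (Uq.action q (Uq.Xz q) φ.1)⟩)

theorem horDiff_apply (φ : LineBundle q n) : (horDiff q n φ).1 =
    Form1.of (Uq.action q (Uq.Xm q) φ.1) (Uq.action q (Uq.Xp q) φ.1) 0 :=
  Form1.ext (sub_zero (Uq.action q (Uq.Xm q) φ.1)) (sub_zero (Uq.action q (Uq.Xp q) φ.1))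
    (sub_self (Uq.action q (Uq.Xz q) φ.1))

variable (q) in
/-- The canonical connection `L_n → L_n ⊗ Ω¹`, that is `(id - Π_z) ∘ d` under the identification
`φ ⊗ ω ↦ φ ω`. -/
def nabla : LineBundle q n →ₗ[ℂ] LForm1 q n := (mulEquiv q n).symm.toLinearMap ∘ₗ horDiff q n

theorem mulMap_nabla (φ : LineBundle q n) : mulMap n (nabla q n φ) = horDiff q n φ :=
  (mulEquiv q n).apply_symm_apply _

theorem mulMap_injective : Function.Injective (mulMap (q := q) n) := (mulEquiv q n).injective

variable (q) in
/-- The differential `d f = (X_- ▷ f) β_- + (X_+ ▷ f) β_+` of functions on the projective line. -/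
def diffP0 : Apq q →ₗ[ℂ] FormP1 q where
  toFun f := ⟨Form1.of (Uq.action q (Uq.Xm q) f.1) (Uq.action q (Uq.Xp q) f.1) 0,
    Xm_mem rfl ((mem_Apq_iff _).mp f.2), Xp_mem rfl ((mem_Apq_iff _).mp f.2), rfl⟩
  map_add' f g := Subtype.ext (Form1.ext (map_add _ f.1 g.1) (map_add _ f.1 g.1)
    (add_zero 0).symm)
  map_smul' r f := Subtype.ext (Form1.ext (map_smul _ r f.1) (map_smul _ r f.1)
    (smul_zero r).symm)

variable (q) in
/-- The differential of one-forms on the projective line,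
`d (x β_- + y β_+) = (X_- ▷ y - q² X_+ ▷ x) β_- ∧ β_+`. -/
def diffP1 : FormP1 q →ₗ[ℂ] FormP2 q where
  toFun ω := ⟨Form2.of (Uq.action q (Uq.Xm q) ω.1.2.1 -
      q.val ^ 2 • Uq.action q (Uq.Xp q) ω.1.1) 0 0,
    sub_mem ((mem_Apq_iff _).mpr (Xm_mem (by norm_num) ω.2.2.1))
      (Subalgebra.smul_mem _ ((mem_Apq_iff _).mpr (Xp_mem (by norm_num) ω.2.1)) _), rfl, rfl⟩
  map_add' ω η := Subtype.ext (Form2.ext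
    (by
      change Uq.action q (Uq.Xm q) (ω.1.2.1 + η.1.2.1) -
          q.val ^ 2 • Uq.action q (Uq.Xp q) (ω.1.1 + η.1.1) =
        (Uq.action q (Uq.Xm q) ω.1.2.1 - q.val ^ 2 • Uq.action q (Uq.Xp q) ω.1.1) +
        (Uq.action q (Uq.Xm q) η.1.2.1 - q.val ^ 2 • Uq.action q (Uq.Xp q) η.1.1)
      rw [map_add, map_add, smul_add]; abel)
    (add_zero 0).symm (add_zero 0).symm)
  map_smul' r ω := Subtype.ext (Form2.ext
    (by
      change Uq.action q (Uq.Xm q) (r • ω.1.2.1) -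
          q.val ^ 2 • Uq.action q (Uq.Xp q) (r • ω.1.1) =
        r • (Uq.action q (Uq.Xm q) ω.1.2.1 - q.val ^ 2 • Uq.action q (Uq.Xp q) ω.1.1)
      rw [map_smul, map_smul, smul_sub, smul_comm r])
    (smul_zero r).symm (smul_zero r).symm)

variable (q) in
/-- The wedge product of one-forms on the projective line, the restriction of the wedge product of
one-forms on `SU_q(2)`. -/
def wedgeP : FormP1 q →ₗ[ℂ] FormP1 q →ₗ[ℂ] FormP2 q :=
  LinearMap.mk₂ ℂ
    (fun ω η => ⟨wedge ω.1 η.1,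
      sub_mem (LineBundle.mul_mem_Apq (by norm_num) ω.2.1 (twist_mem η.2.2.1))
        (Subalgebra.smul_mem _
          (LineBundle.mul_mem_Apq (by norm_num) ω.2.2.1 (twist_mem η.2.1)) _),
      by
        change ω.1.1 * twist η.1.2.2 - q.val ^ 4 • (ω.1.2.2 * twist (twist η.1.1)) = 0
        rw [ω.2.2.2, η.2.2.2, map_zero, mul_zero, zero_mul, smul_zero, sub_zero],
      by
        change ω.1.2.1 * twist η.1.2.2 - (q.val ^ 4)⁻¹ • (ω.1.2.2 * twist (twist η.1.2.1)) = 0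
        rw [ω.2.2.2, η.2.2.2, map_zero, mul_zero, zero_mul, smul_zero, sub_zero]⟩)
    (fun ω ω' η => Subtype.ext (wedge_add_left ω.1 ω'.1 η.1))
    (fun r ω η => Subtype.ext (wedge_smul_left r ω.1 η.1))
    (fun ω η η' => Subtype.ext (wedge_add_right ω.1 η.1 η'.1))
    (fun r ω η => Subtype.ext (wedge_smul_right r ω.1 η.1))

theorem wedgeP_smul_left (f : Apq q) (ω η : FormP1 q) :
    wedgeP q (f • ω) η = f • wedgeP q ω η := Subtype.ext (wedge_asu_smul_left f.1 ω.1 η.1)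

theorem wedgeP_balanced (f : Apq q) (ω η : FormP1 q) :
    wedgeP q (MulOpposite.op f • ω) η = wedgeP q ω (f • η) :=
  Subtype.ext (wedge_balanced f.1 ω.1 η.1)

/-- The Leibniz rule `d (f ω) = d f ∧ ω + f d ω` on the projective line. -/
theorem diffP1_smul (f : Apq q) (ω : FormP1 q) :
    diffP1 q (f • ω) = wedgeP q (diffP0 q f) ω + f • diffP1 q ω := by
  refine Subtype.ext (Form2.ext ?_ ?_ ?_)
  · change Uq.action q (Uq.Xm q) (f.1 * ω.1.2.1) -
        q.val ^ 2 • Uq.action q (Uq.Xp q) (f.1 * ω.1.1) =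
      (Uq.action q (Uq.Xm q) f.1 * twist ω.1.2.1 -
        q.val ^ 2 • (Uq.action q (Uq.Xp q) f.1 * twist ω.1.1)) +
      f.1 * (Uq.action q (Uq.Xm q) ω.1.2.1 - q.val ^ 2 • Uq.action q (Uq.Xp q) ω.1.1)
    rw [Uq.Xm_mul, Uq.Xp_mul, mul_sub, smul_add, mul_smul_comm]
    simp only [twist, LinearMap.comp_apply]
    abel
  · exact (Subtype.prop (_ : FormP2 q)).2.1.trans (Subtype.prop (_ : FormP2 q)).2.1.symm
  · exact (Subtype.prop (_ : FormP2 q)).2.2.trans (Subtype.prop (_ : FormP2 q)).2.2.symm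

theorem mulMap_op_smul (f : Apq q) (x : LForm1 q n) :
    (mulMap n (MulOpposite.op f • x)).1 = MulOpposite.op f.1 • (mulMap n x).1 := by
  induction x using BalTensor.induction with
  | h0 => rw [smul_zero, map_zero]; exact (smul_zero (MulOpposite.op f.1)).symm
  | ht φ ω =>
    exact Form1.ext (mul_assoc _ _ _).symm (mul_assoc _ _ _).symm (mul_assoc _ _ _).symm
  | ha x y hx hy =>
    rw [smul_add, map_add, map_add, Submodule.coe_add, Submodule.coe_add, hx, hy, smul_add]

/-- The Leibniz rule `∇ (φ f) = (∇ φ) f + φ ⊗ d f`. -/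
theorem nabla_op_smul (f : Apq q) (φ : LineBundle q n) :
    nabla q n (MulOpposite.op f • φ) =
      MulOpposite.op f • nabla q n φ + BalTensor.tmul (Apq q) φ (diffP0 q f) := by
  apply mulMap_injective
  apply Subtype.ext
  rw [map_add, mulMap_nabla, Submodule.coe_add, mulMap_op_smul, mulMap_nabla, horDiff_apply,
    horDiff_apply, mulMap_tmul]
  refine Form1.ext ?_ ?_ ?_
  · exact (Uq.Xm_mul φ.1 f.1).trans (add_comm _ _)
  · exact (Uq.Xp_mul φ.1 f.1).trans (add_comm _ _)
  · change (0 : ASU q) = 0 * _ + φ.1 * 0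
    rw [zero_mul, mul_zero, add_zero]

/-- The product `(φ ⊗ η) ∧ ω = φ ⊗ (η ∧ ω)`. -/
def wedgeRight (ω : FormP1 q) : LForm1 q n →ₗ[ℂ] LForm2 q n :=
  BalTensor.lTensor ((wedgeP q).flip ω) (fun f η => wedgeP_smul_left f η ω)

theorem wedgeRight_tmul (ω : FormP1 q) (φ : LineBundle q n) (η : FormP1 q) :
    wedgeRight n ω (BalTensor.tmul (Apq q) φ η) = BalTensor.tmul (Apq q) φ (wedgeP q η ω) := rfl

theorem wedgeRight_add (ω η : FormP1 q) (x : LForm1 q n) :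
    wedgeRight n (ω + η) x = wedgeRight n ω x + wedgeRight n η x := by
  induction x using BalTensor.induction with
  | h0 => simp only [map_zero, add_zero]
  | ht φ ζ => simp only [wedgeRight_tmul, map_add]
  | ha x y hx hy => simp only [map_add, hx, hy]; abel

theorem wedgeRight_smul (r : ℂ) (ω : FormP1 q) (x : LForm1 q n) :
    wedgeRight n (r • ω) x = r • wedgeRight n ω x := by
  induction x using BalTensor.induction with
  | h0 => simp only [map_zero, smul_zero]
  | ht φ ζ => simp only [wedgeRight_tmul, map_smul]
  | ha x y hx hy => simp only [map_add, hx, hy, smul_add]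

theorem wedgeRight_op_smul (f : Apq q) (ω : FormP1 q) (x : LForm1 q n) :
    wedgeRight n ω (MulOpposite.op f • x) = wedgeRight n (f • ω) x := by
  induction x using BalTensor.induction with
  | h0 => simp only [map_zero, smul_zero]
  | ht φ ζ => rw [BalTensor.op_smul_tmul, wedgeRight_tmul, wedgeRight_tmul, wedgeP_balanced]
  | ha x y hx hy => rw [smul_add, map_add, map_add, hx, hy]

variable (q) in
/-- The extension of the canonical connection to `L_n ⊗ Ω¹ → L_n ⊗ Ω²` by the Leibniz rule
`∇ (φ ⊗ ω) = (∇ φ) ∧ ω + φ ⊗ d ω`. -/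
def nablaExt : LForm1 q n →ₗ[ℂ] LForm2 q n :=
  BalTensor.lift
    (LinearMap.mk₂ ℂ
      (fun φ ω => wedgeRight n ω (nabla q n φ) + BalTensor.tmul (Apq q) φ (diffP1 q ω))
      (fun φ ψ ω => by simp only [map_add, LinearMap.add_apply]; abel)
      (fun r φ ω => by simp only [map_smul, LinearMap.smul_apply, smul_add])
      (fun φ ω η => by simp only [wedgeRight_add, map_add]; abel)
      (fun r φ ω => by simp only [wedgeRight_smul, map_smul, smul_add]))
    (fun f φ ω => by
      simp only [LinearMap.mk₂_apply]
      rw [nabla_op_smul, map_add, wedgeRight_op_smul, wedgeRight_tmul, diffP1_smul, map_add,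
        BalTensor.smul_tmul, add_assoc])

theorem nablaExt_tmul (φ : LineBundle q n) (ω : FormP1 q) :
    nablaExt q n (BalTensor.tmul (Apq q) φ ω) =
      wedgeRight n ω (nabla q n φ) + BalTensor.tmul (Apq q) φ (diffP1 q ω) := rfl

variable (q) in
/-- The curvature `∇² = ∇ ∘ ∇ : L_n → L_n ⊗ Ω²` of the canonical connection. -/
def curvature : LineBundle q n →ₗ[ℂ] LForm2 q n := nablaExt q n ∘ₗ nabla q n

variable (q) in
/-- The generator `β_- ∧ β_+` of the two-forms on the projective line. -/
def volForm : FormP2 q := ⟨wedge (betaM q) (betaP q), by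
  have h : wedge (betaM q) (betaP q) = Form2.of 1 0 0 := by
    refine Form2.ext ?_ ?_ ?_ <;> simp [wedge, betaM, betaP, Form1.of, Form2.of, twist_one]
  rw [h]
  exact ⟨one_mem _, rfl, rfl⟩⟩

variable {n} in
/-- The element `X_z ▷ φ` of `L_n`. -/
def verticalDeriv (φ : LineBundle q n) : LineBundle q n :=
  ⟨Uq.action q (Uq.Xz q) φ.1, Xz_mem φ.2⟩

end Connection
end

/-! The curvature is a commutator in the enveloping algebra, read off from the coefficient of `β_- ∧
β_+`. Multiplying out `φ ⊗ f β_- ∧ β_+ ↦ φ f` embeds `L_n ⊗ Ω²` in the algebra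
(`volCoef_injective`), because every element of this tensor product has the form `φ ⊗ β_- ∧ β_+`.
The operators `X_±` obey `X (x y) = x (X y) + (X x) (K² y)`, and the factor `K²` is the one produced
when `β_±` moves past `y`. Hence, after multiplying out, the extended connection has the same
formula as the differential of one-forms on the projective line: `x β_- + y β_+` goes to `X_- y - q²
X_+ x` (`volCoef_nablaExt`). Applied to `∇ φ`, where `x = X_- φ` and `y = X_+ φ`, this gives `(X_-
X_+ - q² X_+ X_-) φ`, and the relation for `[E, F]` turns it into `X_z φ` (`Xm_Xp_sub`).

The explicit value requires the spectrum of `K` on `L_n`. The line bundle is defined through the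
circle action, which is a priori unrelated to `K`, so the content is `opK_lineBundle`: `K` acts on
`L_n` as `q ^ (n / 2)`. Each generator lies in some `L_m` with the right `K`-weight, such elements
are closed under products, so they span the algebra; and the `L_m` are independent, so an element of
`L_n` has no component outside weight `n`. Then `X_z = (1 - K⁴) / (1 - q⁻²)` acts on `L_n` as the
scalar `(1 - q ^ (2 n)) / (1 - q⁻²) = -q ^ (n + 1) [n]`.

Right linearity follows from the same fact: `X_z` is a scalar on `L_n`, and for `n = 0` the operator
`K` is the identity, so `β_- ∧ β_+` commutes with functions on the projective line. -/

theorem QParam.val_sq_sub_one_ne_zero (q : QParam) : q.val ^ 2 - 1 ≠ 0 := by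
  have hq := q.val_ne_zero
  intro h
  apply q.sub_inv_ne_zero
  field_simp
  rw [h, mul_zero]

/-! ### The action of `K` and of `X_z` on the line bundles, and the commutator of `X_±`. -/

section Weights

variable {q : QParam}

variable (q) in
/-- The elements of `L_n` on which `K` acts by `q ^ (n / 2)`. -/
noncomputable def weightBundle (n : ℤ) : Submodule ℂ (ASU q) :=
  LineBundle q n ⊓ LinearMap.eqLocus (ASU.opK q) (q.sqrt ^ n • LinearMap.id)

theorem mem_weightBundle {n : ℤ} {x : ASU q} :
    x ∈ weightBundle q n ↔ x ∈ LineBundle q n ∧ ASU.opK q x = q.sqrt ^ n • x := Iff.rfl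

/-- Both conditions are multiplicative because `α_z` and `K ▷` preserve products; the second does so
since `K` is group-like. -/
theorem weightBundle_mul_mem {m n : ℤ} {x y : ASU q} (hx : x ∈ weightBundle q m)
    (hy : y ∈ weightBundle q n) : x * y ∈ weightBundle q (m + n) := by
  rw [mem_weightBundle] at *
  refine ⟨LineBundle.mul_mem rfl hx.1 hy.1, ?_⟩
  rw [ASU.opK_mul, hx.2, hy.2, smul_mul_smul_comm, zpow_add₀ q.sqrt_ne_zero]

theorem one_mem_weightBundle : (1 : ASU q) ∈ weightBundle q 0 := by
  rw [mem_weightBundle, zpow_zero, one_smul]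
  exact ⟨(mem_Apq_iff _).mp (one_mem _), ASU.opK_one⟩

/-- The generators `a, c` have weight `-1` and `a*, c*` have weight `1`, for the circle and for `K`
at once. Products of elements of matching weights again have matching weights, so sums of such
elements form a subalgebra containing the generators. -/
theorem iSup_weightBundle : ⨆ n, weightBundle q n = ⊤ := by
  have hle : ∀ n, weightBundle q n ≤ ⨆ n, weightBundle q n := le_iSup _
  rw [eq_top_iff]
  rintro x -
  induction x using ASU.induction with
  | halg r =>
    rw [Algebra.algebraMap_eq_smul_one]
    exact Submodule.smul_mem _ _ (hle 0 one_mem_weightBundle)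
  | ha => exact hle (-1) (mem_weightBundle.mpr ⟨a_mem, by simp⟩)
  | hc => exact hle (-1) (mem_weightBundle.mpr ⟨c_mem, by simp⟩)
  | has => exact hle 1 (mem_weightBundle.mpr ⟨as_mem, by simp⟩)
  | hcs => exact hle 1 (mem_weightBundle.mpr ⟨cs_mem, by simp⟩)
  | hmul x y hx hy =>
    -- The product is bilinear, so it suffices to multiply two homogeneous elements.
    induction hx using Submodule.iSup_induction' with
    | zero => rw [zero_mul]; exact zero_mem _
    | add u v _ _ hu hv => rw [add_mul]; exact add_mem hu hv
    | mem m u hu =>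
      induction hy using Submodule.iSup_induction' with
      | zero => rw [mul_zero]; exact zero_mem _
      | add s t _ _ hs ht => rw [mul_add]; exact add_mem hs ht
      | mem k s hs => exact hle _ (weightBundle_mul_mem hu hs)
  | hadd x y hx hy => exact add_mem hx hy

/-- The point of the circle at angle one radian has infinite order, since `π` is irrational. One
such point is enough to tell all the characters `z ↦ (z*) ^ n` apart. -/
theorem conj_exp_one_zpow_injective :
    Function.Injective fun n : ℤ => starRingEnd ℂ (Circle.exp 1 : ℂ) ^ n := by
  intro m n h
  have h' : (Circle.exp 1)⁻¹ ^ m = (Circle.exp 1)⁻¹ ^ n := by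
    apply Circle.ext
    rw [Circle.coe_zpow, Circle.coe_zpow, Circle.coe_inv_eq_conj]
    exact h
  rw [← Circle.exp_neg, ← Circle.exp_zsmul, ← Circle.exp_zsmul, Circle.exp_eq_exp] at h'
  obtain ⟨k, hk⟩ := h'
  by_contra hmn
  have hk0 : k ≠ 0 := by
    rintro rfl
    apply hmn
    have h1 : (m : ℝ) = n := by simpa using hk
    exact_mod_cast h1
  -- The equality of angles reads `-m = -n + 2 π k` with `k ≠ 0`, so `π = (n - m) / (2 k)` would be
  -- rational.
  refine irrational_pi ⟨((n - m : ℤ) : ℚ) / ((2 * k : ℤ) : ℚ), ?_⟩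
  have hkR : (k : ℝ) ≠ 0 := Int.cast_ne_zero.mpr hk0
  push_cast
  rw [div_eq_iff (by positivity)]
  simp only [zsmul_eq_mul] at hk
  linarith

variable (q) in
-- Each `L_n` lies in an eigenspace of the single operator `α_z` with `z` at angle one radian. The
-- eigenvalues are distinct for distinct `n`, and eigenspaces of one operator are independent.
theorem iSupIndep_lineBundle : iSupIndep (LineBundle q) :=
  ((Module.End.eigenspaces_iSupIndep (alpha q (Circle.exp 1)).toLinearMap).comp
    conj_exp_one_zpow_injective).mono
    fun _ _ hx => Module.End.mem_eigenspace_iff.mpr (hx (Circle.exp 1))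

/-- `K` acts on `L_n` by `q ^ (n / 2)`. -/
theorem opK_lineBundle {n : ℤ} {x : ASU q} (hx : x ∈ LineBundle q n) :
    ASU.opK q x = q.sqrt ^ n • x := by
  have hle : ∀ m, weightBundle q m ≤ LineBundle q m := fun _ => inf_le_left
  -- Split `x` into a part `y` of weight `n` and a remainder `w` from the other weights. The
  -- remainder equals `x - y`, hence lies in `L_n` as well as in the span of the other line bundles,
  -- and independence kills it.
  have hx' : x ∈ weightBundle q n ⊔ ⨆ m, ⨆ _ : m ≠ n, weightBundle q m := by
    refine (iSup_weightBundle.ge.trans (iSup_le fun m => ?_)) (Submodule.mem_top (x := x))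
    by_cases hm : m = n
    · exact hm ▸ le_sup_left
    · exact le_sup_of_le_right (le_iSup₂ (f := fun m (_ : m ≠ n) => weightBundle q m) m hm)
  obtain ⟨y, hy, w, hw, rfl⟩ := Submodule.mem_sup.mp hx'
  have hwn : w ∈ LineBundle q n := by
    simpa using sub_mem hx (hle n hy)
  have hw0 : w = 0 := Submodule.disjoint_def.mp (iSupIndep_lineBundle q n) w hwn
    (iSup₂_mono (fun m _ => hle m) hw)
  rw [hw0, add_zero]
  exact hy.2

/-- On a line bundle the twisted right multiplication is a rescaling: `β_± x = q ^ n x β_±` for `x`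
in `L_n`. -/
theorem twist_lineBundle {n : ℤ} {x : ASU q} (hx : x ∈ LineBundle q n) :
    twist x = q.val ^ n • x := by
  rw [twist, LinearMap.comp_apply, opK_lineBundle hx, map_smul, opK_lineBundle hx, smul_smul,
    ← mul_zpow, q.val_eq, pow_two]

/-- `X_z` acts on `L_n` by `-q ^ (n + 1) [n]`. -/
theorem Xz_lineBundle {n : ℤ} {x : ASU q} (hx : x ∈ LineBundle q n) :
    Uq.action q (Uq.Xz q) x = -(q.val ^ (n + 1) * q.number n) • x := by
  have h4 : ASU.opK q (ASU.opK q (ASU.opK q (ASU.opK q x))) = (q.val ^ n * q.val ^ n) • x := by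
    change twist (twist x) = _
    rw [twist_lineBundle hx, map_smul, twist_lineBundle hx, smul_smul]
  have hq := q.val_ne_zero
  have hq2 := q.val_sq_sub_one_ne_zero
  rw [Uq.action_Xz, h4, QParam.number, zpow_add₀ hq, zpow_neg, zpow_one]
  have hn : q.val ^ n ≠ 0 := zpow_ne_zero _ hq
  -- With `t = q ^ n` the claim is an identity of rational functions in `q` and `t`, namely `(1 -
  -- t²) / (1 - q⁻²) = -q t (t - t⁻¹) / (q - q⁻¹)`.
  generalize q.val ^ n = t at *
  match_scalars
  field_simp
  ring

/-- The commutation relation `X_- X_+ - q² X_+ X_- = X_z`. -/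
theorem Xm_Xp_sub (x : ASU q) :
    Uq.action q (Uq.Xm q) (Uq.action q (Uq.Xp q) x) -
      q.val ^ 2 • Uq.action q (Uq.Xp q) (Uq.action q (Uq.Xm q) x) = Uq.action q (Uq.Xz q) x := by
  have hs := q.sqrt_ne_zero
  have hq := q.val_ne_zero
  have hq2 := q.val_sq_sub_one_ne_zero
  -- Moving every `K` to the right gives `X_- X_+ = q F E K²` and `q² X_+ X_- = q E F K²`, so the
  -- difference is `-q [E, F] K²`. This is why the relation is taken at `K² x`: there `K² - K⁻²`
  -- becomes `K⁴ - 1`.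
  have h := ASU.opE_opF (ASU.opK q (ASU.opK q x))
  rw [ASU.opKinv_opK, ASU.opKinv_opK, sub_eq_iff_eq_add] at h
  simp only [Uq.action_Xm, Uq.action_Xp, Uq.action_Xz, map_smul, ASU.opK_opE, ASU.opK_opF, h]
  match_scalars <;> field_simp
  rw [sub_self, mul_zero]

end Weights

/-! ### The curvature in terms of the coefficient of `β_- ∧ β_+`. -/

section Curvature

variable {q : QParam} (n : ℤ)

/-- The multiplication map `L_n ⊗ Ω² → A(SU_q(2))`, `φ ⊗ f β_- ∧ β_+ ↦ φ f`. -/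
noncomputable def volCoef : LForm2 q n →ₗ[ℂ] ASU q :=
  BalTensor.lift
    (LinearMap.mk₂ ℂ (fun (φ : LineBundle q n) (ω : FormP2 q) => φ.1 * ω.1.1)
      (fun φ ψ ω => add_mul φ.1 ψ.1 ω.1.1)
      (fun r φ ω => smul_mul_assoc r φ.1 ω.1.1)
      (fun φ ω η => mul_add φ.1 ω.1.1 η.1.1)
      (fun r φ ω => mul_smul_comm r φ.1 ω.1.1))
    (fun f φ ω => mul_assoc φ.1 f.1 ω.1.1)

theorem volCoef_tmul (φ : LineBundle q n) (ω : FormP2 q) :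
    volCoef n (BalTensor.tmul (Apq q) φ ω) = φ.1 * ω.1.1 := rfl

theorem volForm_coef : (volForm q).1.1 = 1 := by
  simp [volForm, wedge, betaM, betaP, Form1.of, Form2.of, twist_one]

theorem volForm_val : (volForm q).1 = Form2.of 1 0 0 :=
  Form2.ext volForm_coef (volForm q).2.2.1 (volForm q).2.2.2

/-- Two-forms on the projective line are a left module of rank one over the functions, generated by
`β_- ∧ β_+`. -/
theorem eq_smul_volForm (ω : FormP2 q) : ω = (⟨ω.1.1, ω.2.1⟩ : Apq q) • volForm q := by
  refine Subtype.ext ?_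
  change ω.1 = ω.1.1 • (volForm q).1
  rw [volForm_val]
  exact Form2.ext (mul_one _).symm (ω.2.2.1.trans (mul_zero _).symm)
    (ω.2.2.2.trans (mul_zero _).symm)

/-- Moving a function past `β_- ∧ β_+` applies `K⁴` to it, and `K` is the identity on `L_0`. -/
theorem op_smul_volForm (f : Apq q) : MulOpposite.op f • volForm q = f • volForm q := by
  have h : ∀ x ∈ LineBundle q 0, twist x = x := fun x hx => by
    rw [twist_lineBundle hx, zpow_zero, one_smul]
  have hf := (mem_Apq_iff _).mp f.2
  refine Subtype.ext ?_
  change MulOpposite.op f.1 • (volForm q).1 = f.1 • (volForm q).1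
  rw [volForm_val]
  refine Form2.ext ?_ ((zero_mul _).trans (mul_zero _).symm)
    ((zero_mul _).trans (mul_zero _).symm)
  change 1 * twist (twist f.1) = f.1 * 1
  rw [h _ hf, h _ hf, one_mul, mul_one]

/-- The coefficient of a two-form is a function on the projective line, so it can be moved across
the balanced tensor product into the line bundle factor. Sums then combine because the right-hand
factor is always the same. -/
theorem exists_tmul_volForm (x : LForm2 q n) :
    ∃ φ : LineBundle q n, x = BalTensor.tmul (Apq q) φ (volForm q) := by
  induction x using BalTensor.induction with
  | h0 => exact ⟨0, by rw [map_zero, LinearMap.zero_apply]⟩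
  | ht φ ω =>
    rw [eq_smul_volForm ω, ← BalTensor.smul_tmul]
    exact ⟨_, rfl⟩
  | ha x y hx hy =>
    obtain ⟨φ, rfl⟩ := hx
    obtain ⟨ψ, rfl⟩ := hy
    exact ⟨φ + ψ, by rw [map_add, LinearMap.add_apply]⟩

/-- Equalities in the quotient `L_n ⊗ Ω²` can thereby be checked in the algebra: on `φ ⊗ β_- ∧ β_+`,
the general element, the map returns `φ`. -/
theorem volCoef_injective : Function.Injective (volCoef (q := q) n) := by
  intro x y h
  obtain ⟨φ, rfl⟩ := exists_tmul_volForm n x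
  obtain ⟨ψ, rfl⟩ := exists_tmul_volForm n y
  rw [volCoef_tmul, volCoef_tmul, volForm_coef, mul_one, mul_one] at h
  rw [Subtype.ext h]

/-- Multiplying out commutes with the wedge product because the wedge is left linear over the whole
algebra, not only over functions on the projective line. -/
theorem volCoef_wedgeRight (ω : FormP1 q) (x : LForm1 q n) :
    volCoef n (wedgeRight n ω x) = (wedge (mulMap n x).1 ω.1).1 := by
  induction x using BalTensor.induction with
  | h0 =>
    rw [map_zero, map_zero, map_zero]
    -- `wedge` is a plain function, so its vanishing at zero is read off from homogeneity with the
    -- scalar `0`.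
    have h := wedge_smul_left 0 (0 : Form1 q) ω.1
    rw [zero_smul, zero_smul] at h
    exact (congrArg Prod.fst h).symm
  | ht φ η =>
    rw [wedgeRight_tmul, volCoef_tmul, mulMap_tmul, wedge_asu_smul_left]
    rfl
  | ha x y hx hy =>
    rw [map_add, map_add, map_add, hx, hy, Submodule.coe_add, wedge_add_left]
    rfl

/-- Under the multiplication maps the extended connection is
`x β_- + y β_+ ↦ (X_- ▷ y - q² X_+ ▷ x) β_- ∧ β_+`. -/
theorem volCoef_nablaExt (x : LForm1 q n) : volCoef n (nablaExt q n x) =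
    Uq.action q (Uq.Xm q) (mulMap n x).1.2.1 -
      q.val ^ 2 • Uq.action q (Uq.Xp q) (mulMap n x).1.1 := by
  induction x using BalTensor.induction with
  | h0 =>
    rw [map_zero, map_zero, map_zero]
    change 0 = Uq.action q (Uq.Xm q) 0 - q.val ^ 2 • Uq.action q (Uq.Xp q) 0
    rw [map_zero, map_zero, smul_zero, sub_zero]
  | ht φ ω =>
    rw [nablaExt_tmul, map_add, volCoef_wedgeRight, mulMap_nabla, horDiff_apply, volCoef_tmul,
      mulMap_tmul]
    change (Uq.action q (Uq.Xm q) φ.1 * twist ω.1.2.1 -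
        q.val ^ 2 • (Uq.action q (Uq.Xp q) φ.1 * twist ω.1.1)) +
      φ.1 * (Uq.action q (Uq.Xm q) ω.1.2.1 - q.val ^ 2 • Uq.action q (Uq.Xp q) ω.1.1) =
      Uq.action q (Uq.Xm q) (φ.1 * ω.1.2.1) - q.val ^ 2 • Uq.action q (Uq.Xp q) (φ.1 * ω.1.1)
    -- In the twisted Leibniz rule, the terms where `X_±` hits `φ` carry `K²` on the form
    -- coefficient and make up `∇ φ ∧ ω`; those where it hits the coefficient make up `φ ⊗ d ω`.
    rw [Uq.Xm_mul, Uq.Xp_mul, mul_sub, smul_add, mul_smul_comm]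
    simp only [twist, LinearMap.comp_apply]
    abel
  | ha x y hx hy =>
    rw [map_add, map_add, map_add, hx, hy]
    change _ = Uq.action q (Uq.Xm q) ((mulMap n x).1.2.1 + (mulMap n y).1.2.1) -
      q.val ^ 2 • Uq.action q (Uq.Xp q) ((mulMap n x).1.1 + (mulMap n y).1.1)
    rw [map_add, map_add, smul_add]
    abel

/-! ### The three assertions about the curvature. -/

variable {n}

/-- Only the product form of `∇ φ`, with coefficients `X_- φ` and `X_+ φ`, enters; the partition of
unity behind the inverse of the multiplication map plays no further role. -/
theorem curvature_eq_verticalDeriv (φ : LineBundle q n) :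
    curvature q n φ = BalTensor.tmul (Apq q) (verticalDeriv φ) (volForm q) := by
  apply volCoef_injective
  rw [curvature, LinearMap.comp_apply, volCoef_nablaExt, mulMap_nabla, horDiff_apply,
    volCoef_tmul, volForm_coef, mul_one]
  exact Xm_Xp_sub φ.1

theorem curvature_eq_smul (φ : LineBundle q n) : curvature q n φ =
    -(q.val ^ (n + 1) * q.number n) • BalTensor.tmul (Apq q) φ (volForm q) := by
  have h : verticalDeriv φ = -(q.val ^ (n + 1) * q.number n) • φ :=
    Subtype.ext (Xz_lineBundle φ.2)
  rw [curvature_eq_verticalDeriv, h, map_smul, LinearMap.smul_apply]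

/-- Two commutations combine: `f` passes `β_- ∧ β_+`, and right multiplication by `f` preserves
`L_n`, on which `X_z` is one scalar. -/
theorem curvature_op_smul (f : Apq q) (φ : LineBundle q n) :
    curvature q n (MulOpposite.op f • φ) = MulOpposite.op f • curvature q n φ := by
  have h : MulOpposite.op f • verticalDeriv φ = verticalDeriv (MulOpposite.op f • φ) := by
    refine Subtype.ext ?_
    change Uq.action q (Uq.Xz q) φ.1 * f.1 = Uq.action q (Uq.Xz q) (φ.1 * f.1)
    have hφf : φ.1 * f.1 ∈ LineBundle q n := (MulOpposite.op f • φ).2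
    rw [Xz_lineBundle φ.2, Xz_lineBundle hφf, smul_mul_assoc]
  rw [curvature_eq_verticalDeriv, curvature_eq_verticalDeriv, BalTensor.op_smul_tmul,
    op_smul_volForm, ← BalTensor.smul_tmul, h]

end Curvature

theorem mainTheorem12 (q : QParam) (n : ℤ) :
    (∀ φ : LineBundle q n,
      curvature q n φ = BalTensor.tmul (Apq q) (verticalDeriv φ) (volForm q)) ∧
    (∀ (f : Apq q) (φ : LineBundle q n),
      curvature q n (MulOpposite.op f • φ) = MulOpposite.op f • curvature q n φ) ∧
    (∀ φ : LineBundle q n,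
      curvature q n φ = -(q.val ^ (n + 1) * q.number n) • BalTensor.tmul (Apq q) φ (volForm q)) := by
  exact ⟨curvature_eq_verticalDeriv, curvature_op_smul, curvature_eq_smul⟩
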